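/- **Setting.** Let $N\in\mathbb N$, let $\omega_1,\dots,\omega_N\in\mathbb R$ and $\lambda\in\mathbb R$, and let $v_1,\dots,v_N\in L^2((0,\infty))$ be such that for all $m,n$ $$v_m^*(\omega)v_n(\omega)=\frac{\pi_{mn}(\omega)}{\rho_{mn}(\omega)}\qquad\text{for almost every }\omega>0,$$ where $\pi_{mn},\rho_{mn}$ are complex polynomials, $\rho_{mn}$ has no zeros in $[0,\infty)$, $\deg\pi_{mn}+2\le\deg\rho_{mn}$ and $\pi_{mn}(0)=0$. On $\mathcal H=\mathbb C^N\oplus L^2((0,\infty))$ let $H=H_0+\lambda V$, where $$H_0(c,f)=\bigl((\omega_nc_n)_n,\ \omega f(\omega)\bigr),\qquad V(c,f)=\Bigl((\langle v_n,f\rangle)_n,\ \sum_n c_nv_n\Bigr),$$ with domain $D(H)=D(H_0)=\{(c,f)\in\mathcal H:\int_0^\infty|\omega f(\omega)|^2d\omega<\infty\}$. Let $|n\rangle$ be the standard basis vectors of $\mathbb C^N\oplus\{0\}$, and let $\tilde R(z)$ be the $N\times N$ matrix with entries $\tilde R_{mn}(z)=\langle m|(H-z)^{-1}|n\rangle$,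 for $z$ in the resolvent set of $H$ (the reduced resolvent). Let $S_{mn}(z)=\int_0^\infty \frac{v_m^*(\omega)v_n(\omega)}{\omega-z}\,d\omega$ for $z\in(\mathbb C\setminus[0,\infty))\cup\{0\}$, let $\Gamma(z)$ be the matrix with entries $\pi_{mn}(z)/\rho_{mn}(z)$, let $\Gamma_1=\Gamma'(0)$, and define $A(z)$ on $\mathbb C\setminus[0,\infty)$ by $$S(z)=S(0)+A(z)-\log(-z)\,\Gamma(z).$$ For $z\in\mathbb C\setminus[0,\infty)$ the logarithm $\log z$ is taken with $0<\arg z<2\pi$, and $\log(-z)=\log z-\pi i$. Put $K(0)=\mathrm{diag}(\omega_1,\dots,\omega_N)-\lambda^2S(0)$, $M=\ker K(0)\subset\mathbb C^N$, $$M_2=\Bigl\{\psi\in M:\ -\lambda\,\frac{\sum_n\psi_nv_n(\omega)}{\omega}\in L^2((0,\infty))\Bigr\},\qquad M_0=M^\perp,\qquad M_1=(M_0\oplus M_2)^\perp,$$ and let $Q_1,Q_2$ be the orthogonal projections of $\mathbb C^N$ onto $M_1,M_2$. **Statement.** Assume that $0$ is an exceptional point of the first kind for $H$, i.e. $Q_1\ne0$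 and $Q_2=0$. Then: * $A(z)=zA_1+O(z^2)$ as $z\to0$ in $\mathbb C\setminus[0,\infty)$ for some (necessarily unique) matrix $A_1$. Moreover $Q_1\Gamma_1Q_1$ is invertible in $M_1$. Let $(Q_1\Gamma_1Q_1)^{-1}$ be its inverse in $M_1$, extended by $0$ to $M_1^\perp$. * All $z\in\mathbb C\setminus[0,\infty)$ close enough to $0$ lie in the resolvent set of $H$, and $\tilde R$ is differentiable at each of them. * For $r=0,1$, as $z\to0$ in $\mathbb C\setminus[0,\infty)$, $$\Bigl\|\frac{d^r}{dz^r}\Bigl[\tilde R(z)-\frac{(Q_1\Gamma_1Q_1)^{-1}}{\lambda^2z\log z}-\frac{(Q_1\Gamma_1Q_1)^{-1}\bigl(Q_1+\lambda^2Q_1A_1Q_1+\lambda^2\pi i\,Q_1\Gamma_1Q_1\bigr)(Q_1\Gamma_1Q_1)^{-1}}{\lambda^4z(\log z)^2}\Bigr]\Bigr\|=O\bigl(z^{-1-r}(\log z)^{-3}\bigr).$$ * For $r=0,1$, as $z\to0$ in $\mathbb C\setminus[0,\infty)$, with $\ell(z)=\log z-2\pi i$, $$\Bigl\|\frac{d^r}{dz^r}\Bigl[\tilde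 R(z)-\frac{(Q_1\Gamma_1Q_1)^{-1}}{\lambda^2z\,\ell(z)}-\frac{(Q_1\Gamma_1Q_1)^{-1}\bigl(Q_1+\lambda^2Q_1A_1Q_1-\lambda^2\pi i\,Q_1\Gamma_1Q_1\bigr)(Q_1\Gamma_1Q_1)^{-1}}{\lambda^4z\,\ell(z)^2}\Bigr]\Bigr\|=O\bigl(z^{-1-r}\ell(z)^{-3}\bigr).$$ Here $\|\cdot\|$ is the operator norm on $N\times N$ matrices. -/

import Mathlib

open MeasureTheory Set Filter Asymptotics
open scoped Topology Polynomial InnerProductSpace ComplexConjugate Matrix.Norms.L2Operator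

noncomputable section

/-! ### Resolvents of unbounded operators -/

/-- `R` is the bounded, everywhere defined, two-sided inverse of `T - z`. -/
def IsResolventAt {E : Type*} [NormedAddCommGroup E] [NormedSpace ℂ E]
    (T : E →ₗ.[ℂ] E) (z : ℂ) (R : E →L[ℂ] E) : Prop :=
  (∀ y : E, ∃ h : R y ∈ T.domain, T ⟨R y, h⟩ - z • R y = y) ∧
    ∀ x : T.domain, R (T x - z • (x : E)) = (x : E)

/-- The resolvent set of an unbounded operator, i.e. the complement of its spectrum. -/
def unboundedResolventSet {E : Type*} [NormedAddCommGroup E] [NormedSpace ℂ E]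
    (T : E →ₗ.[ℂ] E) : Set ℂ :=
  {z | ∃ R : E →L[ℂ] E, IsResolventAt T z R}

open Classical in
/-- The resolvent `(T - z)⁻¹` for `z` in the resolvent set (and `0` for other `z`). -/
def unboundedResolvent {E : Type*} [NormedAddCommGroup E] [NormedSpace ℂ E]
    (T : E →ₗ.[ℂ] E) (z : ℂ) : E →L[ℂ] E :=
  if h : ∃ R : E →L[ℂ] E, IsResolventAt T z R then h.choose else 0

/-! ### The `N`-level Friedrichs model -/

/-- Lebesgue measure on the half line `(0, ∞)`. -/
abbrev halfLine : Measure ℝ := volume.restrict (Ioi (0 : ℝ))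

/-- The Hilbert space `ℂ^N ⊕ L²((0, ∞))`. -/
abbrev FriedrichsSpace (N : ℕ) : Type :=
  WithLp 2 (EuclideanSpace ℂ (Fin N) × Lp ℂ 2 halfLine)

/-- Data of the `N`-level Friedrichs model with rational products of form factors: the discrete
levels `ω_n`, the coupling constant `λ`, the form factors `v_n ∈ L²((0, ∞))`, and polynomials
`π_mn`, `ρ_mn` with `v_m^* v_n = π_mn / ρ_mn` on `(0, ∞)`. -/
structure FriedrichsModel (N : ℕ) where
  /-- the discrete energy levels `ω_n` -/
  level : Fin N → ℝ
  /-- the coupling constant `λ` -/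
  coupling : ℝ
  /-- the form factors `v_n` -/
  formFactor : Fin N → Lp ℂ 2 halfLine
  /-- the numerators `π_mn` -/
  num : Fin N → Fin N → ℂ[X]
  /-- the denominators `ρ_mn` -/
  den : Fin N → Fin N → ℂ[X]
  formFactor_mul : ∀ m n, ∀ᵐ ω : ℝ ∂halfLine,
    conj (formFactor m ω) * formFactor n ω
      = (num m n).eval (ω : ℂ) / (den m n).eval (ω : ℂ)
  den_ne_zero : ∀ m n, ∀ ω : ℝ, 0 ≤ ω → (den m n).eval (ω : ℂ) ≠ 0
  degree_le : ∀ m n, (num m n).degree + 2 ≤ (den m n).degree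
  num_zero : ∀ m n, (num m n).eval 0 = 0

namespace FriedrichsModel

variable {N : ℕ} (F : FriedrichsModel N)

/-- The free Hamiltonian `H₀ (c, f) = ((ω_n c_n)_n, ω f)` with domain
`{(c, f) | ∫ |ω f(ω)|² dω < ∞}`. -/
def freeHamiltonian : FriedrichsSpace N →ₗ.[ℂ] FriedrichsSpace N where
  domain :=
    { carrier := {Ψ | MemLp (fun ω : ℝ => (ω : ℂ) * Ψ.snd ω) 2 halfLine}
      zero_mem' := by
        refine (memLp_congr_ae ?_).2 (MemLp.zero (ε := ℂ))
        filter_upwards [Lp.coeFn_zero ℂ 2 halfLine] with ω h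
        simp only [WithLp.zero_snd, h, Pi.zero_apply, mul_zero]
      add_mem' := by
        intro Φ Ψ hΦ hΨ
        refine (memLp_congr_ae ?_).2 (MemLp.add hΦ hΨ)
        filter_upwards [Lp.coeFn_add Φ.snd Ψ.snd] with ω h
        simp only [WithLp.add_snd, h, Pi.add_apply, mul_add]
      smul_mem' := by
        intro c Ψ hΨ
        refine (memLp_congr_ae ?_).2 (MemLp.const_smul hΨ c)
        filter_upwards [Lp.coeFn_smul c Ψ.snd] with ω h
        simp [h, mul_left_comm] }
  toFun :=
    { toFun := fun Ψ => WithLp.toLp 2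
        (WithLp.toLp 2 fun n => (F.level n : ℂ) * (Ψ : FriedrichsSpace N).fst n,
          MemLp.toLp (fun ω : ℝ => (ω : ℂ) * (Ψ : FriedrichsSpace N).snd ω) Ψ.2)
      map_add' := by
        intro Φ Ψ
        apply (WithLp.equiv 2 _).injective
        refine Prod.ext ?_ ?_
        · ext n
          simp [mul_add]
        · refine Eq.trans ?_ (MemLp.toLp_add Φ.2 Ψ.2)
          refine MemLp.toLp_congr (Φ + Ψ).2 (MemLp.add Φ.2 Ψ.2) ?_
          filter_upwards [Lp.coeFn_add (Φ : FriedrichsSpace N).snd (Ψ : FriedrichsSpace N).snd]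
            with ω h
          simp only [Submodule.coe_add, WithLp.add_snd, h, Pi.add_apply, mul_add]
      map_smul' := by
        intro c Ψ
        apply (WithLp.equiv 2 _).injective
        refine Prod.ext ?_ ?_
        · ext n
          simp [mul_left_comm]
        · refine Eq.trans ?_ (MemLp.toLp_const_smul c Ψ.2)
          refine MemLp.toLp_congr (c • Ψ).2 (MemLp.const_smul Ψ.2 c) ?_
          filter_upwards [Lp.coeFn_smul c (Ψ : FriedrichsSpace N).snd] with ω h
          simp [h, mul_left_comm] }

/-- The interaction `V (c, f) = ((⟨v_n, f⟩)_n, ∑ c_n v_n)`. -/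
def interaction : FriedrichsSpace N →ₗ[ℂ] FriedrichsSpace N where
  toFun Ψ := WithLp.toLp 2
    (WithLp.toLp 2 fun n => ⟪F.formFactor n, Ψ.snd⟫_ℂ, ∑ n, Ψ.fst n • F.formFactor n)
  map_add' Φ Ψ := by
    apply (WithLp.equiv 2 _).injective
    refine Prod.ext ?_ ?_
    · ext n
      simp [inner_add_right]
    · simp [add_smul, Finset.sum_add_distrib]
  map_smul' c Ψ := by
    apply (WithLp.equiv 2 _).injective
    refine Prod.ext ?_ ?_
    · ext n
      simp [inner_smul_right]
    · simp [mul_smul, Finset.smul_sum]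

/-- The Hamiltonian `H = H₀ + λ V`, with the domain of `H₀`. -/
def hamiltonian : FriedrichsSpace N →ₗ.[ℂ] FriedrichsSpace N :=
  ((F.coupling : ℂ) • F.interaction) +ᵥ F.freeHamiltonian

/-- The basis vector `|n⟩` of `ℂ^N ⊕ {0}`. -/
def ket (n : Fin N) : FriedrichsSpace N :=
  WithLp.toLp 2 (EuclideanSpace.single n (1 : ℂ), (0 : Lp ℂ 2 halfLine))

/-- The reduced resolvent, `R̃_mn(z) = ⟨m| (H - z)⁻¹ |n⟩`. -/
def reducedResolvent (z : ℂ) : Matrix (Fin N) (Fin N) ℂ :=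
  Matrix.of fun m n => ⟪ket m, unboundedResolvent F.hamiltonian z (ket n)⟫_ℂ

/-- The self energy, `S_mn(z) = ∫_0^∞ v_m^*(ω) v_n(ω) / (ω - z) dω`, for `z` off `(0, ∞)`. -/
def selfEnergy (z : ℂ) : Matrix (Fin N) (Fin N) ℂ :=
  Matrix.of fun m n =>
    ∫ ω : ℝ, conj (F.formFactor m ω) * F.formFactor n ω / ((ω : ℂ) - z) ∂halfLine

/-- The meromorphic continuation `Γ_mn(z) = π_mn(z) / ρ_mn(z)` of `v_m^* v_n`. -/
def Gam (z : ℂ) : Matrix (Fin N) (Fin N) ℂ :=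
  Matrix.of fun m n => (F.num m n).eval z / (F.den m n).eval z

/-- `Γ₁`, the coefficient of `z` in the Taylor expansion of `Γ(z)` at `0`. -/
def Gam₁ : Matrix (Fin N) (Fin N) ℂ :=
  Matrix.of fun m n => deriv (fun z => F.Gam z m n) 0

/-- `A(z)`, defined through `S(z) = S(0) + A(z) - log(-z) Γ(z)` on `ℂ \ [0, ∞)`, where `log(-z)` is
the principal branch. -/
def regularPart (z : ℂ) : Matrix (Fin N) (Fin N) ℂ :=
  F.selfEnergy z - F.selfEnergy 0 + Complex.log (-z) • F.Gam z

/-- `K(0) = K₀ - λ² S(0)`, where `K₀ = diag(ω_1, …, ω_N)`. -/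
def kernelMatrix : Matrix (Fin N) (Fin N) ℂ :=
  Matrix.diagonal (fun n => (F.level n : ℂ)) - (F.coupling : ℂ) ^ 2 • F.selfEnergy 0

/-- `M`, the zero eigenspace of `K(0)`. -/
def M : Submodule ℂ (EuclideanSpace ℂ (Fin N)) :=
  LinearMap.ker (Matrix.toEuclideanLin F.kernelMatrix)

/-- `M₂`, the space of those `ψ ∈ M` for which `f(ω) = -λ (∑ ψ_n v_n(ω)) / ω` is square
integrable on `(0, ∞)`. -/
def M₂ : Submodule ℂ (EuclideanSpace ℂ (Fin N)) where
  carrier := {ψ | ψ ∈ F.M ∧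
    MemLp (fun ω : ℝ => -(F.coupling : ℂ) * (∑ n, ψ n * F.formFactor n ω) / (ω : ℂ)) 2 halfLine}
  zero_mem' := ⟨F.M.zero_mem, by simp⟩
  add_mem' := by
    rintro φ ψ ⟨hφ, hφ'⟩ ⟨hψ, hψ'⟩
    refine ⟨F.M.add_mem hφ hψ, ?_⟩
    convert hφ'.add hψ' using 1
    ext ω
    simp only [PiLp.add_apply, add_mul, Finset.sum_add_distrib, Pi.add_apply]
    ring
  smul_mem' := by
    rintro c ψ ⟨hψ, hψ'⟩
    refine ⟨F.M.smul_mem c hψ, ?_⟩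
    convert hψ'.const_smul c using 1
    ext ω
    simp only [PiLp.smul_apply, smul_eq_mul, mul_assoc, ← Finset.mul_sum, Pi.smul_apply]
    ring

/-- `M₀ = M^⊥`. -/
def M₀ : Submodule ℂ (EuclideanSpace ℂ (Fin N)) := F.Mᗮ

/-- `M₁ = (M₀ ⊕ M₂)^⊥`. -/
def M₁ : Submodule ℂ (EuclideanSpace ℂ (Fin N)) := (F.M₀ ⊔ F.M₂)ᗮ

/-- `Q₁`, the matrix of the orthogonal projection onto `M₁`. -/
def Q₁ : Matrix (Fin N) (Fin N) ℂ := (Matrix.toEuclideanCLM (𝕜 := ℂ) (n := Fin N)).symm F.M₁.starProjection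

/-- `Q₂`, the matrix of the orthogonal projection onto `M₂`. -/
def Q₂ : Matrix (Fin N) (Fin N) ℂ := (Matrix.toEuclideanCLM (𝕜 := ℂ) (n := Fin N)).symm F.M₂.starProjection

/-- `0` is an exceptional point of the first kind: a resonance but not an eigenvalue. -/
def IsExceptionalFirstKind : Prop := F.Q₁ ≠ 0 ∧ F.Q₂ = 0

/-- `Q₁ Γ₁ Q₁` -/
def compressedGam₁ : Matrix (Fin N) (Fin N) ℂ := F.Q₁ * F.Gam₁ * F.Q₁

/-- `X` is the inverse of `Q₁ Γ₁ Q₁` in `M₁`, extended by zero to the orthogonal complement of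
`M₁`. (There is at most one such `X`.) -/
def IsInverseOnM₁ (X : Matrix (Fin N) (Fin N) ℂ) : Prop :=
  F.Q₁ * X = X ∧ X * F.Q₁ = X ∧ F.compressedGam₁ * X = F.Q₁ ∧ X * F.compressedGam₁ = F.Q₁

/-- With `L` a value of a logarithm of `z`, `X = (Q₁ Γ₁ Q₁)⁻¹` and `s = ±1`, the two-term series
`(λ² z L)⁻¹ X + (λ⁴ z L²)⁻¹ X (Q₁ + λ² Q₁ A₁ Q₁ + s λ² π i Q₁ Γ₁ Q₁) X`. -/
def twoTermSeries (X A₁ : Matrix (Fin N) (Fin N) ℂ) (s L z : ℂ) : Matrix (Fin N) (Fin N) ℂ :=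
  ((F.coupling : ℂ) ^ 2 * z * L)⁻¹ • X +
    ((F.coupling : ℂ) ^ 4 * z * L ^ 2)⁻¹ •
      (X * (F.Q₁ + (F.coupling : ℂ) ^ 2 • (F.Q₁ * A₁ * F.Q₁)
        + (s * (F.coupling : ℂ) ^ 2 * Real.pi * Complex.I) • F.compressedGam₁) * X)

end FriedrichsModel

/-- The cut plane `ℂ \ [0, ∞)`. -/
def cutPlane : Set ℂ := ((fun x : ℝ => (x : ℂ)) '' Ici 0)ᶜ

/-- The branch of `log z` on `ℂ \ [0, ∞)` with `0 < arg z < 2π`; it satisfies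
`log(-z) = log z - π i`. -/
def cutLog (z : ℂ) : ℂ := Complex.log (-z) + Real.pi * Complex.I

end

/-! ### Inverses of logarithmic perturbations in a Banach algebra -/

/-! The Feshbach formula identifies the reduced resolvent with the inverse of `K₀ - z - λ² S(z)`
(`exists_isResolventAt`). A Cauchy integral computation gives `A(z) = z α(z)` and `Γ(z) = z γ(z)`
with `α`, `γ` analytic at `0` (`exists_regularPart_eq`, `exists_Gam_eq`), so the matrix to invert is
`K(0) - z - λ² z α(z) + λ² z log(-z) γ(z)`.

As `z → 0` it degenerates on `ker K(0)`, which is the range of `Q₁` because `M₂ = 0`; there its size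
is `z log z`. Multiplying on the right by `(1 - Q₁) + (λ² z L)⁻¹ Q₁`, with `L` a branch of the
logarithm, removes the degeneracy: the product tends to `K(0) + Γ₁ Q₁` with an error expandable in
`L⁻¹`. A Neumann expansion of its inverse, multiplied back, yields the two terms and the bounds
(`inverse_log_expansion`, `threshold_expansion`).

Invertibility of `K(0) + Γ₁ Q₁` reduces to that of `Q₁ Γ₁ Q₁` on `M₁`. If the form of `Γ₁` vanishes
at `ψ ∈ M`, then `|∑ ψ_n v_n(ω)|² = ⟨ψ, Γ(ω) ψ⟩ = O(ω²)`, so `∑ ψ_n v_n / ω` is square integrable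
and `ψ ∈ M₂ = 0` (`mem_M₂_of_form_eq_zero`). -/

/-- Derivative of the inverse along a curve in a Banach algebra. -/
theorem HasDerivAt.ringInverse_of_isUnit {𝔸 : Type*} [NormedRing 𝔸] [NormedAlgebra ℂ 𝔸]
    [CompleteSpace 𝔸] {E : ℂ → 𝔸} {E' : 𝔸} {z : ℂ} (hE : HasDerivAt E E' z) (hu : IsUnit (E z)) :
    HasDerivAt (fun w => Ring.inverse (E w))
      (-(Ring.inverse (E z) * E' * Ring.inverse (E z))) z := by
  obtain ⟨u, hu⟩ := hu
  have h := hasFDerivAt_ringInverse (𝕜 := ℂ) u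
  rw [hu] at h
  have := h.comp_hasDerivAt z hE
  rw [← hu, Ring.inverse_unit]
  simpa [Function.comp_def] using this

section LogarithmicScale

variable {l : Filter ℂ} {L : ℂ → ℂ}

/-- `L` behaves like a branch of the logarithm near `0` along the filter `l`. -/
structure IsLogBranch (l : Filter ℂ) (L : ℂ → ℂ) : Prop where
  ne_zero : ∀ᶠ z in l, z ≠ 0
  hasDerivAt : ∀ᶠ z in l, HasDerivAt L z⁻¹ z
  tendsto_norm : Tendsto (fun z => ‖L z‖) l atTop
  tendsto_mul_pow : ∀ k : ℕ, Tendsto (fun z => z * L z ^ k) l (𝓝 0)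

theorem IsLogBranch.log_ne_zero (h : IsLogBranch l L) : ∀ᶠ z in l, L z ≠ 0 := by
  filter_upwards [h.tendsto_norm.eventually_gt_atTop 0] with z hz using norm_pos_iff.1 hz

theorem IsLogBranch.tendsto_inv (h : IsLogBranch l L) : Tendsto (fun z => (L z)⁻¹) l (𝓝 0) := by
  rw [tendsto_zero_iff_norm_tendsto_zero]
  simpa [Pi.inv_def] using h.tendsto_norm.inv_tendsto_atTop

/-- If `g = f k` eventually and `f` has a limit, then `g = O(k)`. -/
theorem isBigO_of_eventually_eq_mul {g f k : ℂ → ℂ} (hg : ∀ᶠ z in l, g z = f z * k z)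
    {a : ℂ} (hf : Tendsto f l (𝓝 a)) : g =O[l] k := by
  have : (fun z => f z * k z) =O[l] fun z => (1 : ℂ) * k z := (hf.isBigO_one ℂ).mul (isBigO_refl k l)
  simpa using this.congr' (hg.mono fun z hz => hz.symm) EventuallyEq.rfl

variable {𝔸 : Type*} [NormedRing 𝔸] [NormedAlgebra ℂ 𝔸] [CompleteSpace 𝔸]

/-- Neumann expansion to first order in `L⁻¹`; `r` is smaller than every power of `L⁻¹`. Since a
bound on `F` says nothing about its derivative, `F'` is computed exactly from `(E⁻¹)' = -E⁻¹ E' E⁻¹`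
and estimated separately. -/
theorem inverse_log_expansion (h : IsLogBranch l L) {U V W : 𝔸} (hUV : U * V = 1) (hVU : V * U = 1)
    {r r' : ℂ → 𝔸} (hr : r =O[l] fun z => z * L z) (hdr : ∀ᶠ z in l, HasDerivAt r (r' z) z)
    (hr' : r' =O[l] L) :
    ∃ I F F' : ℂ → 𝔸,
      (∀ᶠ z in l, (U - (L z)⁻¹ • W + r z) * I z = 1 ∧ I z * (U - (L z)⁻¹ • W + r z) = 1) ∧
      (∀ z, I z = V + (L z)⁻¹ • (V * W * V) + F z) ∧
      (∀ᶠ z in l, HasDerivAt F (F' z) z) ∧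
      (F =O[l] fun z => (L z ^ 2)⁻¹) ∧ (F' =O[l] fun z => (z * L z ^ 3)⁻¹) := by
  have hr2 : r =O[l] fun z => (L z ^ 2)⁻¹ := by
    refine hr.trans (isBigO_of_eventually_eq_mul (f := fun z => z * L z ^ 3) ?_
      (h.tendsto_mul_pow 3))
    filter_upwards [h.log_ne_zero] with z hz
    field_simp
  have hL2 : (fun z => (L z ^ 2)⁻¹) =O[l] fun z => (L z)⁻¹ :=
    isBigO_of_eventually_eq_mul (.of_forall fun z => by rw [← mul_inv, sq]) h.tendsto_inv
  have hr1 : r =O[l] fun z => (L z)⁻¹ := hr2.trans hL2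
  have hr0 : Tendsto r l (𝓝 0) := hr1.trans_tendsto h.tendsto_inv
  set E : ℂ → 𝔸 := fun z => U - (L z)⁻¹ • W + r z with hE
  set u : 𝔸ˣ := ⟨U, V, hUV, hVU⟩ with hu
  have hElim : Tendsto E l (𝓝 (u : 𝔸)) := by
    have : Tendsto E l (𝓝 (U - (0 : ℂ) • W + 0)) :=
      (tendsto_const_nhds.sub (h.tendsto_inv.smul_const W)).add hr0
    simpa [hu] using this
  have hunit : ∀ᶠ z in l, IsUnit (E z) := hElim.eventually (Units.nhds u)
  set I : ℂ → 𝔸 := fun z => Ring.inverse (E z) with hI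
  have hIlim : Tendsto I l (𝓝 V) := by
    have h1 := (NormedRing.inverse_continuousAt u).tendsto.comp hElim
    rwa [Ring.inverse_unit] at h1
  have hI1 : I =O[l] fun _ => (1 : ℂ) := hIlim.isBigO_one ℂ
  have hWs : (fun z => (L z)⁻¹ • W - r z) =O[l] fun z => (L z)⁻¹ := by
    refine IsBigO.sub ?_ hr1
    simpa using (isBigO_refl (fun z => (L z)⁻¹) l).smul (isBigO_const_const W (one_ne_zero (α := ℂ)) l)
  have hmulc : ∀ (X : 𝔸), (fun _ : ℂ => X) =O[l] fun _ => (1 : ℂ) := fun X =>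
    isBigO_const_const X one_ne_zero l
  -- Second resolvent identity: `I - V = I (U - E) V`.
  have hIV_eq : ∀ᶠ z in l, I z - V = I z * ((L z)⁻¹ • W - r z) * V := by
    filter_upwards [hunit] with z hz
    have e1 : I z * E z = 1 := Ring.inverse_mul_cancel _ hz
    have e2 : (L z)⁻¹ • W - r z = U - E z := by simp only [hE]; abel
    rw [e2, mul_sub, sub_mul, e1, mul_assoc, hUV, mul_one, one_mul]
  have hIV : (fun z => I z - V) =O[l] fun z => (L z)⁻¹ := by
    refine IsBigO.congr' ?_ (hIV_eq.mono fun z hz => hz.symm) EventuallyEq.rfl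
    simpa using (hI1.mul hWs).mul (hmulc V)
  -- Defining `F` as the difference makes the expansion hold at every `z`, including those where
  -- `Ring.inverse` takes its default value `0`.
  set F : ℂ → 𝔸 := fun z => I z - V - (L z)⁻¹ • (V * W * V) with hF
  set F' : ℂ → 𝔸 := fun z => -((z * L z ^ 2)⁻¹ • (I z * W * I z - V * W * V)) - I z * r' z * I z
    with hF'
  refine ⟨I, F, F', ?_, fun z => by simp only [hF]; abel, ?_, ?_, ?_⟩
  · filter_upwards [hunit] with z hz using
      ⟨Ring.mul_inverse_cancel _ hz, Ring.inverse_mul_cancel _ hz⟩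
  · filter_upwards [hunit, hdr, h.hasDerivAt, h.log_ne_zero, h.ne_zero] with z hz hrz hLz hL0 hz0
    have hinv : HasDerivAt (fun w => (L w)⁻¹) (-(z * L z ^ 2)⁻¹) z := by
      have := hLz.inv hL0
      convert! this using 1
      field_simp
    have hEd : HasDerivAt E ((z * L z ^ 2)⁻¹ • W + r' z) z := by
      have := ((hinv.smul_const W).const_sub U).add hrz
      simpa using! this
    have := ((hEd.ringInverse_of_isUnit hz).sub_const V).sub (hinv.smul_const (V * W * V))
    convert! this using 1
    simp only [hF', hI, mul_add, add_mul, smul_sub, neg_smul, mul_smul_comm, smul_mul_assoc]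
    abel
  · have hFeq : ∀ᶠ z in l, F z = (I z - V) * ((L z)⁻¹ • (W * V)) - I z * r z * V := by
      filter_upwards [hIV_eq] with z hz
      simp only [hF]
      conv_lhs => rw [hz]
      simp only [mul_sub, sub_mul, mul_smul_comm, smul_mul_assoc, mul_assoc, smul_sub]
      abel
    refine IsBigO.congr' ?_ (hFeq.mono fun z hz => hz.symm) EventuallyEq.rfl
    refine IsBigO.sub ?_ ?_
    · have h1 := hIV.mul ((isBigO_refl (fun z => (L z)⁻¹) l).smul (hmulc (W * V)))
      refine h1.congr_right fun z => ?_
      simp [sq]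
    · simpa using (hI1.mul hr2).mul (hmulc V)
  · refine IsBigO.sub (IsBigO.neg_left ?_) ?_
    -- The derivative of `L⁻¹` is `-(z L²)⁻¹`; the third power of `L` comes from the cancellation `I
    -- W I - V W V = O(L⁻¹)`.
    · have h1 : (fun z => I z * W * I z - V * W * V) =O[l] fun z => (L z)⁻¹ := by
        have h2 : (fun z => (I z - V) * W * I z + V * W * (I z - V)) =O[l] fun z => (L z)⁻¹ := by
          refine IsBigO.add ?_ ?_
          · simpa using (hIV.mul (hmulc W)).mul hI1
          · simpa using (hmulc (V * W)).mul hIV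
        refine h2.congr_left fun z => ?_
        simp only [sub_mul, mul_sub]
        abel
      refine ((isBigO_refl (fun z => (z * L z ^ 2)⁻¹) l).smul h1).congr_right fun z => ?_
      simp only [smul_eq_mul, ← mul_inv]
      ring
    · have h1 : (fun z => I z * r' z * I z) =O[l] L := by
        simpa using (hI1.mul hr').mul hI1
      refine h1.trans (isBigO_of_eventually_eq_mul (f := fun z => z * L z ^ 4) ?_
        (h.tendsto_mul_pow 4))
      filter_upwards [h.log_ne_zero, h.ne_zero] with z hz hz0
      field_simp

end LogarithmicScale

/-! ### Inversion at a threshold with logarithmic degeneracy -/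

section ThresholdExpansion

variable {l : Filter ℂ} {L : ℂ → ℂ}
  {𝔸 : Type*} [NormedRing 𝔸] [NormedAlgebra ℂ 𝔸] [CompleteSpace 𝔸]

theorem IsLogBranch.one_isBigO (h : IsLogBranch l L) : (fun _ : ℂ => (1 : ℂ)) =O[l] L :=
  isBigO_of_eventually_eq_mul (f := fun z => (L z)⁻¹)
    (h.log_ne_zero.mono fun z hz => by field_simp) h.tendsto_inv

theorem IsLogBranch.id_isBigO_one (h : IsLogBranch l L) : (fun z : ℂ => z) =O[l] fun _ => (1 : ℂ) := by
  simpa using (h.tendsto_mul_pow 0).isBigO_one ℂ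

/-- The inverse of `K - z - κ z α(z) + κ z (L - c) γ(z)` up to relative order `L⁻²`, when `K` is
singular with kernel projection `Q` and the compression of `γ(0)` to the range of `Q` has
inverse `X`. -/
theorem threshold_expansion (h : IsLogBranch l L) (hl : l ≤ 𝓝 0) {K Q X V : 𝔸} {α γ : ℂ → 𝔸}
    {κ : ℂ} (c : ℂ) (hκ : κ ≠ 0) (hα : AnalyticAt ℂ α 0) (hγ : AnalyticAt ℂ γ 0)
    (hQ : Q * Q = Q) (hKQ : K * Q = 0) (hQX : Q * X = X) (hXQ : X * Q = X)
    (hUV : (K + γ 0 * Q) * V = 1) (hVU : V * (K + γ 0 * Q) = 1) (hQV : Q * V = X)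
    (B : ℂ → 𝔸)
    (hB : ∀ᶠ z in l, B z = K - z • 1 - (κ * z) • α z + (κ * z * (L z - c)) • γ z) :
    ∃ R ε ε' : ℂ → 𝔸,
      (∀ᶠ z in l, B z * R z = 1 ∧ R z * B z = 1) ∧
      (∀ z, R z = (κ * z * L z)⁻¹ • X + (κ ^ 2 * z * L z ^ 2)⁻¹ •
        (X * (Q + κ • (Q * α 0 * Q) + (κ * c) • (Q * γ 0 * Q)) * X) + ε z) ∧
      (∀ᶠ z in l, HasDerivAt ε (ε' z) z) ∧
      (ε =O[l] fun z => (z * L z ^ 3)⁻¹) ∧ (ε' =O[l] fun z => (z ^ 2 * L z ^ 3)⁻¹) := by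
  have hmulc : ∀ (X : 𝔸), (fun _ : ℂ => X) =O[l] fun _ => (1 : ℂ) := fun X =>
    isBigO_const_const X one_ne_zero l
  have h1L := h.one_isBigO
  have hz1 := h.id_isBigO_one
  have hLinv : (fun z => (L z)⁻¹) =O[l] fun _ => (1 : ℂ) := h.tendsto_inv.isBigO_one ℂ
  have hα1 : α =O[l] fun _ => (1 : ℂ) := (hα.continuousAt.tendsto.mono_left hl).isBigO_one ℂ
  have hγ1 : γ =O[l] fun _ => (1 : ℂ) := (hγ.continuousAt.tendsto.mono_left hl).isBigO_one ℂ
  have hα1' : deriv α =O[l] fun _ => (1 : ℂ) :=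
    (hα.deriv.continuousAt.tendsto.mono_left hl).isBigO_one ℂ
  have hγ1' : deriv γ =O[l] fun _ => (1 : ℂ) :=
    (hγ.deriv.continuousAt.tendsto.mono_left hl).isBigO_one ℂ
  have hα0 : (fun z => α z - α 0) =O[l] fun z => z := by
    simpa using hα.differentiableAt.isBigO_sub.mono hl
  have hγ0 : (fun z => γ z - γ 0) =O[l] fun z => z := by
    simpa using hγ.differentiableAt.isBigO_sub.mono hl
  have hαd : ∀ᶠ z in l, HasDerivAt α (deriv α z) z :=
    hl (hα.eventually_analyticAt.mono fun z hz => hz.differentiableAt.hasDerivAt)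
  have hγd : ∀ᶠ z in l, HasDerivAt γ (deriv γ z) z :=
    hl (hγ.eventually_analyticAt.mono fun z hz => hz.differentiableAt.hasDerivAt)
  have hinv : ∀ᶠ z in l, HasDerivAt (fun w => (L w)⁻¹) (-(z * L z ^ 2)⁻¹) z := by
    filter_upwards [h.hasDerivAt, h.log_ne_zero, h.ne_zero] with z hLz hL0 hz0
    have := hLz.inv hL0
    convert! this using 1
    field_simp
  have hLc : (fun z => L z - c) =O[l] L := by
    refine (isBigO_refl L l).sub ?_
    simpa using (isBigO_refl (fun _ : ℂ => c) l).trans ((isBigO_const_const c one_ne_zero l).trans h1L)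
  have hLc1 : (fun z => 1 - c * (L z)⁻¹) =O[l] fun _ => (1 : ℂ) :=
    (isBigO_refl _ l).sub (by simpa using hLinv.const_mul_left c)
  -- Chosen so that `B = K + z β`.
  set β : ℂ → 𝔸 := fun z => -1 - κ • α z + (κ * (L z - c)) • γ z with hβ
  have hβL : β =O[l] L := by
    refine IsBigO.add (IsBigO.sub ?_ ?_) ?_
    · exact (hmulc (-1)).trans h1L
    · exact (hα1.const_smul_left κ).trans h1L
    · simpa using (hLc.const_mul_left κ).smul hγ1
  -- What is left of `B D` after its limit and its `L⁻¹` term: `z β` off the range of `Q`, and the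
  -- increments of `α` and `γ` from `0` on it.
  set r : ℂ → 𝔸 := fun z => z • β z * (1 - Q) +
    (-((L z)⁻¹ • (α z - α 0)) + (1 - c * (L z)⁻¹) • (γ z - γ 0)) * Q with hr_def
  set r' : ℂ → 𝔸 := fun z =>
    (β z + z • (-(κ • deriv α z)) + κ • γ z + (κ * (z * (L z - c))) • deriv γ z) * (1 - Q) +
    ((z * L z ^ 2)⁻¹ • (α z - α 0) - (L z)⁻¹ • deriv α z
      + (c * (z * L z ^ 2)⁻¹) • (γ z - γ 0) + (1 - c * (L z)⁻¹) • deriv γ z) * Q with hr'_def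
  have hzzL : (fun z : ℂ => z) =O[l] fun z => z * L z := by
    simpa using (isBigO_refl (fun z : ℂ => z) l).mul h1L
  have hr : r =O[l] fun z => z * L z := by
    refine IsBigO.add ?_ ?_
    · simpa using ((isBigO_refl (fun z : ℂ => z) l).smul hβL).mul (hmulc (1 - Q))
    · refine IsBigO.trans ?_ hzzL
      have : (fun z => -((L z)⁻¹ • (α z - α 0)) + (1 - c * (L z)⁻¹) • (γ z - γ 0)) =O[l]
          fun z => z := by
        refine IsBigO.add (IsBigO.neg_left ?_) ?_
        · simpa using hLinv.smul hα0
        · simpa using hLc1.smul hγ0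
      simpa using this.mul (hmulc Q)
  have hzL2 : ∀ f : ℂ → 𝔸, (f =O[l] fun z => z) →
      (fun z => (z * L z ^ 2)⁻¹ • f z) =O[l] fun _ => (1 : ℂ) := by
    intro f hf
    refine ((isBigO_refl (fun z : ℂ => (z * L z ^ 2)⁻¹) l).smul hf).trans ?_
    refine isBigO_of_eventually_eq_mul (f := fun z => (L z)⁻¹ * (L z)⁻¹) ?_
      (h.tendsto_inv.mul h.tendsto_inv)
    filter_upwards [h.ne_zero, h.log_ne_zero] with z hz hz'
    simp only [smul_eq_mul]
    field_simp
  have hr' : r' =O[l] L := by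
    refine IsBigO.add ?_ ?_
    · suffices (fun z => β z + z • (-(κ • deriv α z)) + κ • γ z +
          (κ * (z * (L z - c))) • deriv γ z) =O[l] L by simpa using this.mul (hmulc (1 - Q))
      refine IsBigO.add (IsBigO.add (IsBigO.add hβL ?_) ?_) ?_
      · refine IsBigO.trans ?_ h1L
        simpa using hz1.smul (hα1'.const_smul_left κ).neg_left
      · exact (hγ1.const_smul_left κ).trans h1L
      · have := (((hz1.mul hLc).const_mul_left κ).smul hγ1')
        simpa using this
    · refine IsBigO.trans ?_ h1L
      suffices (fun z => (z * L z ^ 2)⁻¹ • (α z - α 0) - (L z)⁻¹ • deriv α z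
          + (c * (z * L z ^ 2)⁻¹) • (γ z - γ 0) + (1 - c * (L z)⁻¹) • deriv γ z) =O[l]
          fun _ => (1 : ℂ) by simpa using this.mul (hmulc Q)
      refine IsBigO.add (IsBigO.add (IsBigO.sub (hzL2 _ hα0) ?_) ?_) ?_
      · simpa using hLinv.smul hα1'
      · simpa only [mul_smul] using! (hzL2 _ hγ0).const_smul_left c
      · simpa using hLc1.smul hγ1'
  have hdr : ∀ᶠ z in l, HasDerivAt r (r' z) z := by
    filter_upwards [hαd, hγd, hinv, h.hasDerivAt, h.ne_zero] with z hαz hγz hLi hLz hz0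
    have hβd : HasDerivAt β (-(κ • deriv α z) + ((κ * (L z - c)) • deriv γ z + (κ * z⁻¹) • γ z)) z := by
      have := ((hαz.const_smul κ).const_sub (-1)).add (((hLz.sub_const c).const_mul κ).smul hγz)
      simpa using! this
    have h1 := (((hasDerivAt_id z).smul hβd).mul_const (1 - Q)).add
      (((hLi.smul (hαz.sub_const (α 0))).neg.add
        (((hLi.const_mul c).const_sub 1).smul (hγz.sub_const (γ 0)))).mul_const Q)
    convert! h1 using 1
    simp only [hr'_def, id, one_smul, smul_add, smul_smul]
    congr 2
    · have : z * (κ * z⁻¹) = κ := by field_simp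
      rw [this, show κ * (z * (L z - c)) = z * (κ * (L z - c)) by ring]
      abel
    · simp only [neg_smul, mul_neg, neg_neg]
      abel
  obtain ⟨I, F, F', hI, hIF, hFd, hF, hF'⟩ :=
    inverse_log_expansion h (W := (c • γ 0 + κ⁻¹ • 1 + α 0) * Q) hUV hVU hr hdr hr'
  -- With `α`, `γ` frozen at `0`, `(κ L)⁻¹ β = γ - L⁻¹ (c γ + κ⁻¹ + α)`; `W` is the bracket
  -- restricted to the range of `Q`.
  set W : 𝔸 := (c • γ 0 + κ⁻¹ • 1 + α 0) * Q with hW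
  -- As `K Q = 0`, the product `B Q = z β Q` has size `z L`; `D` rescales exactly this part.
  set D : ℂ → 𝔸 := fun z => (1 - Q) + (κ * z * L z)⁻¹ • Q with hD
  have hQQ : Q * (1 - Q) = 0 := by rw [mul_sub, mul_one, hQ, sub_self]
  have hQQ' : (1 - Q) * Q = 0 := by rw [sub_mul, one_mul, hQ, sub_self]
  have hQQ'' : (1 - Q) * (1 - Q) = 1 - Q := by rw [mul_sub, hQQ', mul_one, sub_zero]
  have hBD : ∀ᶠ z in l, B z * D z = K + γ 0 * Q - (L z)⁻¹ • W + r z := by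
    filter_upwards [hB, h.log_ne_zero, h.ne_zero] with z hz hL0 hz0
    have e1 : B z = K + z • β z := by
      rw [hz]
      simp only [hβ, smul_add, smul_sub, smul_smul, smul_neg]
      rw [mul_comm z κ, show z * (κ * (L z - c)) = κ * z * (L z - c) by ring]
      abel
    have e2 : (κ * z * L z)⁻¹ • (z • β z * Q) = (γ 0 * Q - (L z)⁻¹ • W) +
        (-((L z)⁻¹ • (α z - α 0)) + (1 - c * (L z)⁻¹) • (γ z - γ 0)) * Q := by
      simp only [hβ, hW, smul_smul, ← smul_mul_assoc, ← sub_mul, ← add_mul]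
      congr 1
      have e3 : (κ * z * L z)⁻¹ * z = κ⁻¹ * (L z)⁻¹ := by field_simp
      have e4 : κ⁻¹ * (L z)⁻¹ * κ = (L z)⁻¹ := by field_simp
      have e5 : κ⁻¹ * (L z)⁻¹ * (κ * (L z - c)) = 1 - c * (L z)⁻¹ := by field_simp
      rw [e3]
      simp only [smul_add, smul_sub, smul_smul, smul_neg, e4, e5]
      module
    rw [e1, hD]
    have e6 : K * (1 - Q) = K := by rw [mul_sub, mul_one, hKQ, sub_zero]
    simp only [mul_add, add_mul, mul_smul_comm, e6, hKQ, zero_add, e2, hr_def]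
    abel
  have hD1 : ∀ᶠ z in l, D z * ((1 - Q) + (κ * z * L z) • Q) = 1 := by
    filter_upwards [h.log_ne_zero, h.ne_zero] with z hL0 hz0
    have : (κ * z * L z)⁻¹ * (κ * z * L z) = 1 := by field_simp
    simp only [hD, mul_add, add_mul, smul_mul_assoc, mul_smul_comm, hQQ, hQQ', hQQ'', hQ, smul_zero,
      smul_add, smul_smul]
    rw [mul_comm (κ * z * L z), this]
    simp
  have hQVW : Q * (V * W * V) = X * (c • γ 0 + κ⁻¹ • 1 + α 0) * X := by
    rw [hW, ← mul_assoc, ← mul_assoc, hQV]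
    rw [← mul_assoc, mul_assoc _ Q V, hQV]
  -- Only the `Q` component of `D I` is singular. The `1 - Q` component stays bounded, hence is
  -- negligible because `z L³ → 0`.
  set ε : ℂ → 𝔸 := fun z => (1 - Q) * (V + (L z)⁻¹ • (V * W * V) + F z) +
    (κ * z * L z)⁻¹ • (Q * F z) with hε
  set ε' : ℂ → 𝔸 := fun z => (1 - Q) * (-(z * L z ^ 2)⁻¹ • (V * W * V) + F' z) +
    ((κ * z * L z)⁻¹ • (Q * F' z) -
      (κ⁻¹ * (1 + (L z)⁻¹) * (z ^ 2 * L z)⁻¹) • (Q * F z)) with hε'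
  have h1zL : (fun _ : ℂ => (1 : ℂ)) =O[l] fun z => (z * L z ^ 3)⁻¹ :=
    isBigO_of_eventually_eq_mul (f := fun z => z * L z ^ 3) (by
      filter_upwards [h.log_ne_zero, h.ne_zero] with z hL0 hz0
      field_simp) (h.tendsto_mul_pow 3)
  have hF1 : F =O[l] fun _ => (1 : ℂ) := by
    refine hF.trans ?_
    refine ((h.tendsto_inv.pow 2).isBigO_one ℂ).congr_left fun z => by rw [inv_pow]
  have hF'2 : F' =O[l] fun z => (z ^ 2 * L z ^ 3)⁻¹ := by
    refine hF'.trans (isBigO_of_eventually_eq_mul (f := fun z => z * L z ^ 0) ?_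
      (h.tendsto_mul_pow 0))
    filter_upwards [h.log_ne_zero, h.ne_zero] with z hL0 hz0
    field_simp
  have hscal : (fun z => (κ * z * L z)⁻¹) =O[l] fun z => (z * L z)⁻¹ :=
    ((isBigO_refl (fun z => (z * L z)⁻¹) l).const_mul_left κ⁻¹).congr_left fun z => by
      rw [← mul_inv, mul_assoc]
  refine ⟨fun z => D z * I z, ε, ε', ?_, ?_, ?_, ?_, ?_⟩
  · filter_upwards [hI, hBD, hD1] with z hIz hz hDz
    rw [← hz] at hIz
    refine ⟨by rw [← mul_assoc]; exact hIz.1, ?_⟩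
    -- A right inverse `G` of `D` suffices: `D I B = D (I B D) G = D G = 1`.
    calc D z * I z * B z = D z * I z * B z * (D z * ((1 - Q) + (κ * z * L z) • Q)) := by
          rw [hDz, mul_one]
      _ = D z * (I z * (B z * D z)) * ((1 - Q) + (κ * z * L z) • Q) := by
          simp only [mul_assoc]
      _ = 1 := by rw [hIz.2, mul_one, hDz]
  · intro z
    have e1 : X * (Q + κ • (Q * α 0 * Q) + (κ * c) • (Q * γ 0 * Q)) * X
        = κ • (X * (c • γ 0 + κ⁻¹ • 1 + α 0) * X) := by
      have t1 : X * (Q * α 0 * Q) * X = X * α 0 * X := by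
        rw [← mul_assoc, ← mul_assoc, hXQ, mul_assoc _ Q X, hQX]
      have t2 : X * (Q * γ 0 * Q) * X = X * γ 0 * X := by
        rw [← mul_assoc, ← mul_assoc, hXQ, mul_assoc _ Q X, hQX]
      simp only [mul_add, add_mul, mul_smul_comm, smul_mul_assoc, t1, t2, hXQ, mul_one, smul_add,
        smul_smul, mul_inv_cancel₀ hκ, one_smul]
      abel
    rw [e1, ← hQVW]
    simp only [hD, hε, hIF, add_mul, mul_add, smul_mul_assoc, mul_smul_comm, hQV, smul_add,
      smul_smul]
    have e2 : (κ ^ 2 * z * L z ^ 2)⁻¹ * κ = (κ * z * L z)⁻¹ * (L z)⁻¹ := by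
      field_simp
    rw [e2, mul_comm (L z)⁻¹]
    abel
  · filter_upwards [hFd, hinv, h.hasDerivAt, h.log_ne_zero, h.ne_zero] with z hFz hLi hLz hL0 hz0
    have hs : HasDerivAt (fun z => (κ * z * L z)⁻¹) (-(κ⁻¹ * (1 + (L z)⁻¹) * (z ^ 2 * L z)⁻¹)) z := by
      have := (((hasDerivAt_id z).const_mul κ).mul hLz).inv
        (mul_ne_zero (mul_ne_zero hκ hz0) hL0)
      convert! this using 1
      simp only [id, Pi.mul_apply]
      field_simp
    have := (((hLi.smul_const (V * W * V)).const_add V).add hFz).const_mul (1 - Q)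
      |>.add (hs.smul (hFz.const_mul Q))
    convert! this using 1
    simp only [hε', neg_smul, sub_eq_add_neg]
  · refine IsBigO.add ?_ ?_
    · refine IsBigO.trans ?_ h1zL
      have : (fun z => V + (L z)⁻¹ • (V * W * V) + F z) =O[l] fun _ => (1 : ℂ) := by
        refine IsBigO.add (IsBigO.add (hmulc V) ?_) hF1
        simpa using hLinv.smul (hmulc (V * W * V))
      simpa using (hmulc (1 - Q)).mul this
    · refine (hscal.smul ((hmulc Q).mul hF)).congr_right fun z => ?_
      simp only [smul_eq_mul, one_mul, ← mul_inv]
      ring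
  · refine IsBigO.add ?_ (IsBigO.sub ?_ ?_)
    · have : (fun z => -(z * L z ^ 2)⁻¹ • (V * W * V) + F' z) =O[l]
          fun z => (z ^ 2 * L z ^ 3)⁻¹ := by
        refine IsBigO.add ?_ hF'2
        have h2 : (fun z => (z * L z ^ 2)⁻¹) =O[l] fun z => (z ^ 2 * L z ^ 3)⁻¹ :=
          isBigO_of_eventually_eq_mul (f := fun z => z * L z ^ 1) (by
            filter_upwards [h.log_ne_zero, h.ne_zero] with z hL0 hz0
            field_simp) (h.tendsto_mul_pow 1)
        simpa using h2.neg_left.smul (hmulc (V * W * V))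
      simpa using (hmulc (1 - Q)).mul this
    · refine (hscal.smul ((hmulc Q).mul hF')).trans ?_
      refine isBigO_of_eventually_eq_mul (f := fun z => (L z)⁻¹) ?_ h.tendsto_inv
      filter_upwards [h.log_ne_zero, h.ne_zero] with z hL0 hz0
      simp only [smul_eq_mul, one_mul]
      field_simp
    · have h2 : (fun z => κ⁻¹ * (1 + (L z)⁻¹) * (z ^ 2 * L z)⁻¹) =O[l] fun z => (z ^ 2 * L z)⁻¹ :=
        isBigO_of_eventually_eq_mul (f := fun z => κ⁻¹ * (1 + (L z)⁻¹)) (.of_forall fun z => rfl)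
          ((h.tendsto_inv.const_add 1).const_mul κ⁻¹)
      refine (h2.smul ((hmulc Q).mul hF)).congr_right fun z => ?_
      simp only [smul_eq_mul, one_mul, ← mul_inv]
      ring

end ThresholdExpansion

/-! ### The logarithm on the cut plane -/

theorem mem_cutPlane_iff {z : ℂ} : z ∈ cutPlane ↔ -z ∈ Complex.slitPlane := by
  rw [Complex.mem_slitPlane_iff, cutPlane, mem_compl_iff, ← not_iff_not, not_not]
  constructor
  · rintro ⟨x, hx, rfl⟩
    simpa using hx
  · intro h
    push Not at h
    refine ⟨z.re, ?_, Complex.ext (by simp) ?_⟩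
    · simpa using h.1
    · simpa using! (neg_eq_zero.1 h.2).symm

theorem isOpen_cutPlane : IsOpen cutPlane := by
  have : cutPlane = (fun z : ℂ => -z) ⁻¹' Complex.slitPlane := by
    ext z; exact mem_cutPlane_iff
  rw [this]
  exact Complex.isOpen_slitPlane.preimage continuous_neg

theorem ne_zero_of_mem_cutPlane {z : ℂ} (hz : z ∈ cutPlane) : z ≠ 0 := by
  rintro rfl
  exact hz ⟨0, by simp, by simp⟩

theorem ofReal_sub_ne_zero_of_mem_cutPlane {z : ℂ} (hz : z ∈ cutPlane) {ω : ℝ} (hω : 0 ≤ ω) :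
    (ω : ℂ) - z ≠ 0 := fun h => hz ⟨ω, hω, sub_eq_zero.1 h⟩

/-- Openness of the cut plane allows identities valid near `0` in it to be differentiated. -/
theorem eventually_eventually_nhds_cutPlane {p : ℂ → Prop} (h : ∀ᶠ z in 𝓝[cutPlane] (0 : ℂ), p z) :
    ∀ᶠ z in 𝓝[cutPlane] (0 : ℂ), ∀ᶠ w in 𝓝 z, p w := by
  filter_upwards [eventually_eventually_nhdsWithin.2 h, self_mem_nhdsWithin] with z hz hz'
  rwa [isOpen_cutPlane.nhdsWithin_eq hz'] at hz

theorem tendsto_mul_abs_log_add_pow (C : ℝ) (k : ℕ) :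
    Tendsto (fun x : ℝ => x * (|Real.log x| + C) ^ k) (𝓝[>] 0) (𝓝 0) := by
  have h1 : (fun x : ℝ => Real.log x + C) =O[atTop] Real.log := by
    refine (isBigO_refl _ _).add ?_
    exact (Real.isLittleO_const_log_atTop (c := C)).isBigO
  have h2 : (fun x : ℝ => (Real.log x + C) ^ k) =o[atTop] fun x => x :=
    (h1.pow k).trans_isLittleO Real.isLittleO_pow_log_id_atTop
  -- Under `x ↦ 1/x` the claim is that powers of the logarithm are `o(x)` at infinity.
  have h3 := (h2.tendsto_div_nhds_zero).comp tendsto_inv_nhdsGT_zero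
  refine h3.congr' ?_
  have : ∀ᶠ x : ℝ in 𝓝[>] 0, x < 1 := nhdsWithin_le_nhds (Iio_mem_nhds one_pos)
  filter_upwards [this, self_mem_nhdsWithin] with x hx hx0
  have hx0 : 0 < x := hx0
  simp only [Function.comp, Real.log_inv, abs_of_neg (Real.log_neg hx0 hx)]
  field_simp

/-- Every branch `log (-z) + c` is a logarithm near `0` on the cut plane. -/
theorem isLogBranch_log_neg_add (c : ℂ) :
    IsLogBranch (𝓝[cutPlane] 0) fun z => Complex.log (-z) + c := by
  have hnorm : Tendsto (fun z : ℂ => ‖z‖) (𝓝[cutPlane] 0) (𝓝[>] 0) := by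
    refine tendsto_nhdsWithin_iff.2 ⟨?_, ?_⟩
    · simpa using (continuous_norm.tendsto (0 : ℂ)).mono_left nhdsWithin_le_nhds
    · filter_upwards [self_mem_nhdsWithin] with z hz using
        norm_pos_iff.2 (ne_zero_of_mem_cutPlane hz)
  refine ⟨?_, ?_, ?_, fun k => ?_⟩
  · filter_upwards [self_mem_nhdsWithin] with z hz using ne_zero_of_mem_cutPlane hz
  · filter_upwards [self_mem_nhdsWithin] with z hz
    have := ((hasDerivAt_id z).neg.clog (mem_cutPlane_iff.1 hz)).add_const c
    convert! this using 1
    simp [neg_div_neg_eq]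
  · have h1 : Tendsto (fun z : ℂ => -Real.log ‖z‖ - ‖c‖) (𝓝[cutPlane] 0) atTop :=
      tendsto_atTop_add_const_right _ _
        (tendsto_neg_atBot_atTop.comp (Real.tendsto_log_nhdsGT_zero.comp hnorm))
    refine tendsto_atTop_mono (fun z => ?_) h1
    have h2 : -Real.log ‖z‖ ≤ ‖Complex.log (-z)‖ := by
      have := (neg_le_abs _).trans (Complex.abs_re_le_norm (Complex.log (-z)))
      simpa [Complex.log_re] using this
    have h3 := norm_sub_norm_le (Complex.log (-z)) (-c)
    rw [norm_neg, sub_neg_eq_add] at h3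
    linarith
  · refine squeeze_zero_norm (fun z => ?_)
      ((tendsto_mul_abs_log_add_pow (Real.pi + ‖c‖) k).comp hnorm)
    simp only [norm_mul, norm_pow, Function.comp]
    gcongr
    have h1 : ‖Complex.log (-z)‖ ≤ |Real.log ‖z‖| + Real.pi := by
      refine (Complex.norm_le_abs_re_add_abs_im _).trans ?_
      rw [Complex.log_re, Complex.log_im, norm_neg]
      gcongr
      exact Complex.abs_arg_le_pi _
    linarith [norm_add_le (Complex.log (-z)) c]

/-! ### Cauchy integrals of rational functions -/

theorem inv_norm_ofReal_sub_le {z : ℂ} (hz : z ∈ Metric.ball (0 : ℂ) 2⁻¹) {ω : ℝ}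
    (hω : ω ∈ Ioi (1 : ℝ)) : (ω : ℂ) - z ≠ 0 ∧ ‖(ω : ℂ) - z‖⁻¹ ≤ 2 := by
  have h2 : (1 : ℝ) < ω := hω
  have h3 : 2⁻¹ ≤ ‖(ω : ℂ) - z‖ := by
    rw [mem_ball_zero_iff] at hz
    have h1 := norm_sub_norm_le (ω : ℂ) z
    rw [Complex.norm_real, Real.norm_of_nonneg (by linarith)] at h1
    linarith
  have h4 : 0 < ‖(ω : ℂ) - z‖ := by linarith
  exact ⟨norm_pos_iff.1 h4, by rwa [inv_le_comm₀ h4 two_pos]⟩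

theorem integrableOn_div_sub {h : ℝ → ℂ} (hh : IntegrableOn h (Ioi 1)) {z : ℂ}
    (hz : z ∈ Metric.ball (0 : ℂ) 2⁻¹) :
    IntegrableOn (fun ω : ℝ => h ω / ((ω : ℂ) - z)) (Ioi 1) := by
  have hm : AEStronglyMeasurable (fun ω : ℝ => h ω / ((ω : ℂ) - z)) (volume.restrict (Ioi 1)) :=
    hh.aestronglyMeasurable.div₀
      (Complex.continuous_ofReal.sub continuous_const).measurable.aestronglyMeasurable
  refine (hh.norm.mul_const 2).mono' hm ?_
  filter_upwards [ae_restrict_mem measurableSet_Ioi] with ω hω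
  rw [norm_div, div_eq_mul_inv]
  gcongr
  exact (inv_norm_ofReal_sub_le hz hω).2

/-- The Cauchy integral of an integrable density on `(1, ∞)` is analytic at `0`. -/
theorem analyticAt_integral_div_sub {h : ℝ → ℂ} (hh : IntegrableOn h (Ioi 1)) :
    AnalyticAt ℂ (fun z : ℂ => ∫ ω in Ioi (1 : ℝ), h ω / ((ω : ℂ) - z)) 0 := by
  have hd : DifferentiableOn ℂ (fun z : ℂ => ∫ ω in Ioi (1 : ℝ), h ω / ((ω : ℂ) - z))
      (Metric.ball 0 2⁻¹) := by
    intro z hz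
    refine (DifferentiableAt.differentiableWithinAt ?_)
    refine (hasDerivAt_integral_of_dominated_loc_of_deriv_le (μ := volume.restrict (Ioi 1))
      (F := fun (z : ℂ) (ω : ℝ) => h ω / ((ω : ℂ) - z))
      (F' := fun (z : ℂ) (ω : ℝ) => h ω / ((ω : ℂ) - z) ^ 2) (bound := fun ω => ‖h ω‖ * 2 ^ 2)
      (Metric.isOpen_ball.mem_nhds hz) ?_ (integrableOn_div_sub hh hz) ?_ ?_
      (hh.norm.mul_const _) ?_).2.differentiableAt
    · filter_upwards [Metric.isOpen_ball.mem_nhds hz] with w hw using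
        (integrableOn_div_sub hh hw).aestronglyMeasurable
    · exact hh.aestronglyMeasurable.div₀
        ((Complex.continuous_ofReal.sub continuous_const).pow 2).measurable.aestronglyMeasurable
    · filter_upwards [ae_restrict_mem measurableSet_Ioi] with ω hω w hw
      rw [norm_div, div_eq_mul_inv, norm_pow, ← inv_pow]
      gcongr
      exact (inv_norm_ofReal_sub_le hw hω).2
    · filter_upwards [ae_restrict_mem measurableSet_Ioi] with ω hω w hw
      have := ((hasDerivAt_id w).const_sub (ω : ℂ)).fun_inv (inv_norm_ofReal_sub_le hw hω).1
        |>.const_mul (h ω)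
      convert! this using 1
      simp [div_eq_mul_inv]
  exact hd.analyticAt (Metric.isOpen_ball.mem_nhds (by simp))

/-- The divided difference of a quotient of polynomials is polynomial up to its denominators. -/
theorem exists_divided_difference (p q : ℂ[X]) :
    ∃ (n : ℕ) (c : ℕ → ℂ[X]), ∀ x z : ℂ, p.eval x * q.eval z - p.eval z * q.eval x =
      (x - z) * ∑ j ∈ Finset.range n, z ^ j * (c j).eval x := by
  -- In `ℂ[X][Y]`, with `x` the inner and `z` the outer variable, `p(x) q(z) - p(z) q(x)` vanishes
  -- at `z = x`, so the factor theorem applies. It produces the factor `z - x`, whence the sign in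
  -- the witness below.
  have hroot : (Polynomial.C p * q.map Polynomial.C - p.map Polynomial.C * Polynomial.C q).IsRoot
      (Polynomial.X : ℂ[X]) := by
    simp [Polynomial.IsRoot.def, Polynomial.eval_map, Polynomial.eval₂_C_X]
  obtain ⟨g, hg⟩ := Polynomial.dvd_iff_isRoot.2 hroot
  refine ⟨g.natDegree + 1, fun j => -g.coeff j, fun x z => ?_⟩
  have h1 := congrArg (fun P => Polynomial.eval x (Polynomial.eval (Polynomial.C z) P)) hg
  have hmap : ∀ r : ℂ[X], Polynomial.eval x (Polynomial.eval (Polynomial.C z) (r.map Polynomial.C))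
      = r.eval z := by
    exact fun r => Polynomial.evalEval_map_C x z r
  simp only [Polynomial.eval_sub, Polynomial.eval_mul, Polynomial.eval_C, Polynomial.eval_X, hmap]
    at h1
  rw [h1, Polynomial.eval_eq_sum_range (p := g), Polynomial.eval_finsetSum, ← neg_sub z x, neg_mul,
    ← mul_neg, ← Finset.sum_neg_distrib]
  congr 1
  refine Finset.sum_congr rfl fun j _ => ?_
  simp
  ring

/-- The principal `log (ω - z)` is an antiderivative on all of `[0, 1]`: `ω - z` could meet the cut
only if `z` were real and at least `ω ≥ 0`. -/
theorem integral_inv_sub_eq_log {z : ℂ} (hz : z ∈ cutPlane) :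
    IntervalIntegrable (fun ω : ℝ => ((ω : ℂ) - z)⁻¹) volume 0 1 ∧
      ∫ ω in (0 : ℝ)..1, ((ω : ℂ) - z)⁻¹ = Complex.log (1 - z) - Complex.log (-z) := by
  have hmem : ∀ ω ∈ uIcc (0 : ℝ) 1, 0 ≤ ω := by
    intro ω hω
    rw [uIcc_of_le zero_le_one] at hω
    exact hω.1
  have hi : IntervalIntegrable (fun ω : ℝ => ((ω : ℂ) - z)⁻¹) volume 0 1 := by
    refine ContinuousOn.intervalIntegrable (ContinuousOn.inv₀ (by fun_prop) fun ω hω => ?_)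
    exact ofReal_sub_ne_zero_of_mem_cutPlane hz (hmem ω hω)
  refine ⟨hi, ?_⟩
  have := intervalIntegral.integral_eq_sub_of_hasDerivAt
    (f := fun ω : ℝ => Complex.log ((ω : ℂ) - z)) (f' := fun ω : ℝ => ((ω : ℂ) - z)⁻¹)
    (a := 0) (b := 1) (fun ω hω => ?_) hi
  · simpa using this
  · have hs : (ω : ℂ) - z ∈ Complex.slitPlane := by
      rw [sub_eq_neg_add, ← sub_neg_eq_add, ← neg_add', ← mem_cutPlane_iff]
      rintro ⟨x, hx, hx'⟩
      refine hz ⟨x + ω, add_nonneg hx (hmem ω hω), ?_⟩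
      simp only [Complex.ofReal_add, hx']
      ring
    have h1 : HasDerivAt (fun w : ℂ => Complex.log (w - z)) ((ω : ℂ) - z)⁻¹ (ω : ℂ) := by
      simpa [one_div] using ((hasDerivAt_id (ω : ℂ)).sub_const z).clog hs
    exact h1.comp_ofReal

/-- The Cauchy integral over `(0, ∞)` of a rational function vanishing at `0` is, up to a
logarithmic term, analytic at `0`. -/
theorem exists_analyticAt_cauchy_integral (p q : ℂ[X])
    (hq : ∀ ω : ℝ, 0 ≤ ω → q.eval (ω : ℂ) ≠ 0) (hp : p.eval 0 = 0)
    (hint : IntegrableOn (fun ω : ℝ => p.eval (ω : ℂ) / q.eval (ω : ℂ)) (Ioi 0)) :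
    ∃ Φ : ℂ → ℂ, AnalyticAt ℂ Φ 0 ∧ Φ 0 = 0 ∧ ∀ᶠ z in 𝓝[cutPlane] (0 : ℂ),
      (∫ ω in Ioi (0 : ℝ), p.eval (ω : ℂ) / q.eval (ω : ℂ) / ((ω : ℂ) - z)) -
        (∫ ω in Ioi (0 : ℝ), p.eval (ω : ℂ) / q.eval (ω : ℂ) / ((ω : ℂ) - 0)) +
        Complex.log (-z) * (p.eval z / q.eval z) = Φ z := by
  obtain ⟨n, c, hc⟩ := exists_divided_difference p q
  have hq0 : q.eval 0 ≠ 0 := by simpa using hq 0 le_rfl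
  set h : ℝ → ℂ := fun ω => p.eval (ω : ℂ) / q.eval (ω : ℂ) with hh
  have hint1 : IntegrableOn h (Ioi 1) := hint.mono_set (Ioi_subset_Ioi zero_le_one)
  set T : ℂ → ℂ := fun z => ∫ ω in Ioi (1 : ℝ), h ω / ((ω : ℂ) - z) with hT
  -- Contribution of the divided difference on `(0, 1)`: a polynomial in `z` divided by `q(z)`.
  set G : ℂ → ℂ := fun z => (q.eval z)⁻¹ * ∑ j ∈ Finset.range n, z ^ j *
    ∫ ω in (0 : ℝ)..1, (c j).eval (ω : ℂ) / q.eval (ω : ℂ) with hG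
  have hcI : ∀ j, IntervalIntegrable (fun ω : ℝ => (c j).eval (ω : ℂ) / q.eval (ω : ℂ)) volume 0 1 := by
    intro j
    refine ContinuousOn.intervalIntegrable (ContinuousOn.div ?_ ?_ fun ω hω => ?_)
    · exact ((c j).continuous.comp Complex.continuous_ofReal).continuousOn
    · exact (q.continuous.comp Complex.continuous_ofReal).continuousOn
    · rw [uIcc_of_le zero_le_one] at hω
      exact hq ω hω.1
  -- The hypotheses are weak enough to include `z = 0`, where `p(0) = 0` removes the singular term.
  have hsplit : ∀ z ∈ Metric.ball (0 : ℂ) 2⁻¹, (∀ ω : ℝ, 0 < ω → (ω : ℂ) - z ≠ 0) →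
      q.eval z ≠ 0 →
      IntervalIntegrable (fun ω : ℝ => p.eval z / q.eval z * ((ω : ℂ) - z)⁻¹) volume 0 1 →
      ∫ ω in Ioi (0 : ℝ), h ω / ((ω : ℂ) - z) =
        G z + (∫ ω in (0 : ℝ)..1, p.eval z / q.eval z * ((ω : ℂ) - z)⁻¹) + T z := by
    intro z hz hne hqz hi
    have hgI : ∀ j ∈ Finset.range n, IntervalIntegrable (fun ω : ℝ =>
        z ^ j * ((c j).eval (ω : ℂ) / q.eval (ω : ℂ))) volume 0 1 :=
      fun j _ => (hcI j).const_mul _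
    have hsI : IntervalIntegrable (fun ω : ℝ => (q.eval z)⁻¹ * ∑ j ∈ Finset.range n,
        z ^ j * ((c j).eval (ω : ℂ) / q.eval (ω : ℂ))) volume 0 1 := by
      have := (IntervalIntegrable.sum (Finset.range n) hgI).const_mul (q.eval z)⁻¹
      simpa [Finset.sum_apply] using! this
    have heq : EqOn (fun ω : ℝ => h ω / ((ω : ℂ) - z)) (fun ω : ℝ => (q.eval z)⁻¹ *
        ∑ j ∈ Finset.range n, z ^ j * ((c j).eval (ω : ℂ) / q.eval (ω : ℂ)) +
          p.eval z / q.eval z * ((ω : ℂ) - z)⁻¹) (Ioc 0 1) := by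
      intro ω hω
      have h1 := hne ω hω.1
      have h2 := hq ω hω.1.le
      have h3 := hc ω z
      have h4 : ∑ j ∈ Finset.range n, z ^ j * ((c j).eval (ω : ℂ) / q.eval (ω : ℂ)) =
          (p.eval (ω : ℂ) * q.eval z - p.eval z * q.eval (ω : ℂ)) / ((ω : ℂ) - z) /
            q.eval (ω : ℂ) := by
        rw [h3, mul_div_cancel_left₀ _ h1, Finset.sum_div]
        exact Finset.sum_congr rfl fun j _ => by ring
      simp only [h4, hh]
      field_simp
      ring
    have hI01 : IntegrableOn (fun ω : ℝ => h ω / ((ω : ℂ) - z)) (Ioc 0 1) := by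
      refine IntegrableOn.congr_fun ?_ heq.symm measurableSet_Ioc
      exact (hsI.add hi).1
    rw [← Ioc_union_Ioi_eq_Ioi (zero_le_one (α := ℝ)), setIntegral_union (Ioc_disjoint_Ioi le_rfl)
      measurableSet_Ioi hI01 (integrableOn_div_sub hint1 hz), setIntegral_congr_fun measurableSet_Ioc heq,
      ← intervalIntegral.integral_of_le zero_le_one, intervalIntegral.integral_add hsI hi,
      intervalIntegral.integral_const_mul, intervalIntegral.integral_finsetSum hgI]
    simp only [intervalIntegral.integral_const_mul, hG, hT]
  have hS0 : ∫ ω in Ioi (0 : ℝ), h ω / ((ω : ℂ) - 0) = G 0 + T 0 := by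
    have := hsplit 0 (by simp) (fun ω hω => by simpa using hω.ne') hq0 (by simp [hp])
    simpa [hp] using this
  -- The integral of `(ω - z)⁻¹` over `(0, 1)` is `log (1 - z) - log (-z)`; the second logarithm
  -- cancels the added term and the first is analytic at `0`.
  refine ⟨fun z => G z + p.eval z / q.eval z * Complex.log (1 - z) + T z - (G 0 + T 0), ?_, ?_, ?_⟩
  · have hpA : ∀ r : ℂ[X], AnalyticAt ℂ (fun z : ℂ => r.eval z) 0 := fun r =>
      r.differentiable.analyticAt 0
    have hlog : AnalyticAt ℂ (fun z : ℂ => Complex.log (1 - z)) 0 :=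
      (analyticAt_const.sub analyticAt_id).clog (by simp)
    have hGA : AnalyticAt ℂ G 0 := by
      refine ((hpA q).inv hq0).mul ?_
      exact Finset.analyticAt_fun_sum _ fun j _ => (analyticAt_id.pow j).mul analyticAt_const
    exact ((hGA.add (((hpA p).div (hpA q) hq0).mul hlog)).add
      (analyticAt_integral_div_sub hint1)).sub analyticAt_const
  · simp [hp]
  · have hqn : ∀ᶠ z in 𝓝 (0 : ℂ), q.eval z ≠ 0 := q.continuous.continuousAt.eventually_ne hq0
    filter_upwards [self_mem_nhdsWithin, nhdsWithin_le_nhds hqn,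
      nhdsWithin_le_nhds (Metric.ball_mem_nhds (0 : ℂ) (by norm_num : (0 : ℝ) < 2⁻¹))] with z hz hqz hzb
    obtain ⟨hi, hi'⟩ := integral_inv_sub_eq_log hz
    rw [hS0, hsplit z hzb (fun ω hω => ofReal_sub_ne_zero_of_mem_cutPlane hz hω.le) hqz
      (hi.const_mul _), intervalIntegral.integral_const_mul, hi']
    ring

/-! ### Matrix-valued functions -/

theorem analyticAt_matrix {N : ℕ} {f : ℂ → Matrix (Fin N) (Fin N) ℂ} {z : ℂ}
    (hf : ∀ m n, AnalyticAt ℂ (fun w => f w m n) z) : AnalyticAt ℂ f z := by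
  have : f = fun w => ∑ m, ∑ n, f w m n • Matrix.single m n (1 : ℂ) := by
    ext w : 1
    conv_lhs => rw [Matrix.matrix_eq_sum_single (f w)]
    simp [Matrix.smul_single]
  rw [this]
  exact Finset.analyticAt_fun_sum _ fun m _ => Finset.analyticAt_fun_sum _ fun n _ =>
    (hf m n).smul analyticAt_const

theorem HasDerivAt.matrix_entry {N : ℕ} {f : ℂ → Matrix (Fin N) (Fin N) ℂ}
    {f' : Matrix (Fin N) (Fin N) ℂ} {z : ℂ} (hf : HasDerivAt f f' z) (m n : Fin N) :
    HasDerivAt (fun w => f w m n) (f' m n) z :=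
  ((Matrix.entryLinearMap ℂ ℂ m n).toContinuousLinearMap.hasFDerivAt.comp_hasDerivAt z hf)

/-- A function vanishing at `0` and analytic there is `z` times an analytic function. -/
theorem AnalyticAt.exists_eq_smul_of_apply_zero {E : Type*} [NormedAddCommGroup E] [NormedSpace ℂ E]
    {f : ℂ → E} (hf : AnalyticAt ℂ f 0) (h0 : f 0 = 0) :
    ∃ g : ℂ → E, AnalyticAt ℂ g 0 ∧ g 0 = deriv f 0 ∧ ∀ z, f z = z • g z := by
  obtain ⟨p, hp⟩ := hf
  refine ⟨dslope f 0, ⟨_, hp.has_fpower_series_dslope_fslope⟩, dslope_same f 0, fun z => ?_⟩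
  simpa [h0] using (sub_smul_dslope f 0 z).symm

/-! ### Extracting a factor `z` from `A(z)` and `Γ(z)` -/

namespace FriedrichsModel

variable {N : ℕ} (F : FriedrichsModel N)

theorem integrableOn_num_div_den (m n : Fin N) :
    IntegrableOn (fun ω : ℝ => (F.num m n).eval (ω : ℂ) / (F.den m n).eval (ω : ℂ)) (Ioi 0) := by
  refine Integrable.congr (L2.integrable_inner (𝕜 := ℂ) (F.formFactor m) (F.formFactor n)) ?_
  filter_upwards [F.formFactor_mul m n] with ω hω
  rw [← hω, RCLike.inner_apply, mul_comm]

theorem selfEnergy_apply (z : ℂ) (m n : Fin N) : F.selfEnergy z m n =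
    ∫ ω in Ioi (0 : ℝ), (F.num m n).eval (ω : ℂ) / (F.den m n).eval (ω : ℂ) / ((ω : ℂ) - z) := by
  refine integral_congr_ae ?_
  filter_upwards [F.formFactor_mul m n] with ω hω
  rw [hω]

theorem den_eval_zero_ne (m n : Fin N) : (F.den m n).eval 0 ≠ 0 := by
  simpa using F.den_ne_zero m n 0 le_rfl

/-- `A(z)` is `z` times a function analytic at `0`. -/
theorem exists_regularPart_eq : ∃ α : ℂ → Matrix (Fin N) (Fin N) ℂ, AnalyticAt ℂ α 0 ∧
    ∀ᶠ z in 𝓝[cutPlane] (0 : ℂ), F.regularPart z = z • α z := by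
  choose Φ hΦ hΦ0 hΦe using fun m n => exists_analyticAt_cauchy_integral (F.num m n) (F.den m n)
    (F.den_ne_zero m n) (F.num_zero m n) (F.integrableOn_num_div_den m n)
  obtain ⟨α, hα, -, hα'⟩ := (analyticAt_matrix (f := fun z => Matrix.of fun m n => Φ m n z)
    (fun m n => hΦ m n)).exists_eq_smul_of_apply_zero (by ext m n; exact hΦ0 m n)
  refine ⟨α, hα, ?_⟩
  filter_upwards [eventually_all.2 fun m => eventually_all.2 fun n => hΦe m n] with z hz
  rw [← hα' z]
  ext m n
  rw [Matrix.of_apply, ← hz m n, regularPart, Matrix.add_apply, Matrix.sub_apply, Matrix.smul_apply,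
    selfEnergy_apply, selfEnergy_apply, Gam, Matrix.of_apply, smul_eq_mul]

theorem analyticAt_Gam : AnalyticAt ℂ F.Gam 0 :=
  analyticAt_matrix fun m n => ((F.num m n).differentiable.analyticAt 0).div
    ((F.den m n).differentiable.analyticAt 0) (F.den_eval_zero_ne m n)

theorem Gam_zero : F.Gam 0 = 0 := by
  ext m n
  simp [Gam, F.num_zero]

theorem deriv_Gam_zero : deriv F.Gam 0 = F.Gam₁ := by
  ext m n
  exact ((F.analyticAt_Gam.differentiableAt.hasDerivAt).matrix_entry m n).deriv.symm

/-- `Γ(z)` is `z` times a function analytic at `0` with value `Γ₁` there. -/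
theorem exists_Gam_eq : ∃ γ : ℂ → Matrix (Fin N) (Fin N) ℂ, AnalyticAt ℂ γ 0 ∧ γ 0 = F.Gam₁ ∧
    ∀ z, F.Gam z = z • γ z := by
  have := F.analyticAt_Gam.exists_eq_smul_of_apply_zero F.Gam_zero
  rwa [deriv_Gam_zero] at this

/-! ### The projection onto the resonant subspace -/

/-- The weight `1/ω` is real, so the integrand at `z = 0` is Hermitian in its two indices. -/
theorem selfEnergy_zero_conjTranspose : (F.selfEnergy 0).conjTranspose = F.selfEnergy 0 := by
  ext m n
  rw [Matrix.conjTranspose_apply, selfEnergy, Matrix.of_apply, Matrix.of_apply]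
  rw [← starRingEnd_apply, ← integral_conj]
  refine integral_congr_ae (.of_forall fun ω => ?_)
  simp [mul_comm]

theorem kernelMatrix_conjTranspose : F.kernelMatrix.conjTranspose = F.kernelMatrix := by
  rw [kernelMatrix, Matrix.conjTranspose_sub, Matrix.conjTranspose_smul,
    selfEnergy_zero_conjTranspose, Matrix.diagonal_conjTranspose]
  congr 2
  · ext n
    simp
  · simp

variable {F}

theorem mulVec_eq_zero_of_mem_M {ψ : EuclideanSpace ℂ (Fin N)} :
    ψ ∈ F.M ↔ F.kernelMatrix.mulVec ψ.ofLp = 0 := by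
  rw [M, LinearMap.mem_ker, Matrix.toLpLin_apply]
  exact WithLp.toLp_eq_zero 2

theorem IsExceptionalFirstKind.M₂_eq_bot (hF : F.IsExceptionalFirstKind) : F.M₂ = ⊥ := by
  have h := hF.2
  rw [Q₂, EmbeddingLike.map_eq_zero_iff] at h
  rw [Submodule.eq_bot_iff]
  intro ψ hψ
  rw [← Submodule.starProjection_eq_self_iff.2 hψ, h]
  rfl

theorem IsExceptionalFirstKind.M₁_eq (hF : F.IsExceptionalFirstKind) : F.M₁ = F.M := by
  rw [M₁, hF.M₂_eq_bot, sup_bot_eq, M₀, Submodule.orthogonal_orthogonal]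

/-- For `λ = 0` the integrability condition in `M₂` is vacuous, so `M = M₂ = 0`, against `Q₁ ≠ 0`.
-/
theorem IsExceptionalFirstKind.coupling_ne_zero (hF : F.IsExceptionalFirstKind) :
    (F.coupling : ℂ) ≠ 0 := by
  intro h
  refine hF.1 ?_
  have hM : F.M = ⊥ := by
    rw [← hF.M₂_eq_bot]
    refine le_antisymm (fun ψ hψ => ⟨hψ, ?_⟩) fun ψ hψ => hψ.1
    simp [h]
  have := hF.M₁_eq.trans hM
  rw [Q₁, EmbeddingLike.map_eq_zero_iff]
  ext1 v
  rw [zero_apply, ← Submodule.mem_bot ℂ, ← this]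
  exact Submodule.starProjection_apply_mem _ _

variable (F) in
theorem toEuclideanCLM_Q₁ :
    Matrix.toEuclideanCLM (𝕜 := ℂ) (n := Fin N) F.Q₁ = F.M₁.starProjection := by
  rw [Q₁, StarAlgEquiv.apply_symm_apply]

theorem Q₁_mulVec (v : EuclideanSpace ℂ (Fin N)) :
    F.Q₁.mulVec v.ofLp = (F.M₁.starProjection v).ofLp := by
  rw [← toEuclideanCLM_Q₁]
  rfl

theorem Q₁_mul_self : F.Q₁ * F.Q₁ = F.Q₁ := by
  rw [Q₁, ← map_mul]
  congr 1
  exact F.M₁.isIdempotentElem_starProjection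

theorem Q₁_conjTranspose : F.Q₁.conjTranspose = F.Q₁ := by
  rw [← Matrix.star_eq_conjTranspose, Q₁]
  refine ((Matrix.toEuclideanCLM (𝕜 := ℂ) (n := Fin N)).symm.map_star' _).symm.trans ?_
  exact congrArg _ (isSelfAdjoint_starProjection F.M₁)

theorem IsExceptionalFirstKind.kernelMatrix_mul_Q₁ (hF : F.IsExceptionalFirstKind) :
    F.kernelMatrix * F.Q₁ = 0 := by
  refine Matrix.ext_of_mulVec_single fun i => ?_
  have h : F.M₁.starProjection (EuclideanSpace.single i (1 : ℂ)) ∈ F.M := by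
    rw [← hF.M₁_eq]
    exact Submodule.starProjection_apply_mem _ _
  rw [mulVec_eq_zero_of_mem_M, ← Q₁_mulVec] at h
  rw [← Matrix.mulVec_mulVec, Matrix.zero_mulVec]
  exact h

theorem IsExceptionalFirstKind.Q₁_mul_kernelMatrix (hF : F.IsExceptionalFirstKind) :
    F.Q₁ * F.kernelMatrix = 0 := by
  have := congrArg Matrix.conjTranspose hF.kernelMatrix_mul_Q₁
  rwa [Matrix.conjTranspose_mul, Q₁_conjTranspose, kernelMatrix_conjTranspose,
    Matrix.conjTranspose_zero] at this

end FriedrichsModel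

/-! ### Nondegeneracy of `Γ₁` on the resonant subspace -/

namespace FriedrichsModel

variable {N : ℕ} {F : FriedrichsModel N}

variable (F) in
theorem memLp_sum_formFactor (ψ : Fin N → ℂ) :
    MemLp (fun ω : ℝ => ∑ n, ψ n * F.formFactor n ω) 2 halfLine :=
  memLp_finsetSum _ fun n _ => (Lp.memLp (F.formFactor n)).const_mul (ψ n)

-- `Γ(ω)` is a rank-one Gram matrix for almost every `ω > 0`. This converts information on the form
-- of `Γ₁` into decay of `∑ ψ_n v_n` at `0`.
variable (F) in
theorem norm_sq_sum_formFactor (ψ : Fin N → ℂ) : ∀ᵐ ω : ℝ ∂halfLine,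
    ((‖∑ n, ψ n * F.formFactor n ω‖ ^ 2 : ℝ) : ℂ) =
      ∑ m, ∑ n, conj (ψ m) * ψ n * F.Gam (ω : ℂ) m n := by
  filter_upwards [ae_all_iff.2 fun m => ae_all_iff.2 fun n => F.formFactor_mul m n] with ω hω
  rw [← Complex.normSq_eq_norm_sq, Complex.normSq_eq_conj_mul_self, map_sum, Finset.sum_mul_sum]
  refine Finset.sum_congr rfl fun m _ => Finset.sum_congr rfl fun n _ => ?_
  rw [Gam, Matrix.of_apply, ← hω m n, map_mul]
  ring

/-- A vector of `M` on which the form of `Γ₁` vanishes belongs to `M₂`. -/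
theorem mem_M₂_of_form_eq_zero {ψ : EuclideanSpace ℂ (Fin N)} (hψ : ψ ∈ F.M)
    (h0 : ∑ m, ∑ n, conj (ψ m) * ψ n * F.Gam₁ m n = 0) : ψ ∈ F.M₂ := by
  refine ⟨hψ, ?_⟩
  obtain ⟨γ, hγ, hγ0, hγe⟩ := F.exists_Gam_eq
  set s : ℝ → ℂ := fun ω => ∑ n, ψ n * F.formFactor n ω with hs
  set g : ℂ → ℂ := fun z => ∑ m, ∑ n, conj (ψ m) * ψ n * γ z m n with hg
  have hg0 : g 0 = 0 := by rw [hg]; simp only [hγ0, h0]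
  have hgd : DifferentiableAt ℂ g 0 := by
    refine DifferentiableAt.fun_sum fun m _ => DifferentiableAt.fun_sum fun n _ => ?_
    exact ((hγ.differentiableAt.hasDerivAt.matrix_entry m n).differentiableAt).const_mul _
  obtain ⟨C, hC, hbound⟩ := hgd.isBigO_sub.exists_pos
  rw [IsBigOWith_def, Metric.eventually_nhds_iff] at hbound
  obtain ⟨δ, hδ, hb⟩ := hbound
  -- Here `|s|² = ω g(ω)`, and `g(0) = 0` gives `|g(ω)| ≤ C ω` for `ω < δ`.
  have hsq : ∀ᵐ ω : ℝ ∂halfLine, ω < δ → ‖s ω‖ ≤ Real.sqrt C * ω := by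
    filter_upwards [F.norm_sq_sum_formFactor ψ, ae_restrict_mem measurableSet_Ioi] with ω hω hω0 hωδ
    have hω0 : 0 < ω := hω0
    have h1 := hb (y := (ω : ℂ)) (by simpa [abs_of_pos hω0] using hωδ)
    have h2 : ((‖s ω‖ ^ 2 : ℝ) : ℂ) = ω * g ω := by
      rw [hω, hg, Finset.mul_sum]
      refine Finset.sum_congr rfl fun m _ => ?_
      rw [Finset.mul_sum]
      refine Finset.sum_congr rfl fun n _ => ?_
      rw [hγe, Matrix.smul_apply, smul_eq_mul]
      ring
    have h3 := congrArg norm h2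
    rw [hg0, sub_zero, sub_zero, Complex.norm_real, Real.norm_of_nonneg hω0.le] at h1
    rw [Complex.norm_real, Real.norm_of_nonneg (by positivity), norm_mul, Complex.norm_real,
      Real.norm_of_nonneg hω0.le] at h3
    refine abs_le_of_sq_le_sq' ?_ (by positivity) |>.2
    rw [mul_pow, Real.sq_sqrt hC.le, h3]
    nlinarith
  have hsm := F.memLp_sum_formFactor ψ.ofLp
  -- Majorant of `λ s / ω`: a constant below `δ` by the previous bound, and `|λ| |s| / δ` from `δ`
  -- on.
  have hmaj : MemLp (fun ω : ℝ => (Ioc 0 δ).indicator (fun _ => ‖F.coupling‖ * Real.sqrt C) ω +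
      ‖F.coupling‖ / δ * ‖s ω‖) 2 halfLine := by
    refine MemLp.add ?_ (hsm.norm.const_mul _)
    refine memLp_indicator_const 2 measurableSet_Ioc _ (Or.inr ?_)
    exact ((Measure.restrict_apply_le _ _).trans_lt measure_Ioc_lt_top).ne
  refine hmaj.mono ?_ ?_
  · exact (hsm.aestronglyMeasurable.const_mul _).div₀
      Complex.continuous_ofReal.measurable.aestronglyMeasurable
  · filter_upwards [hsq, ae_restrict_mem measurableSet_Ioi] with ω hω hω0
    have hω0 : 0 < ω := hω0
    have hind : 0 ≤ (Ioc 0 δ).indicator (fun _ => ‖F.coupling‖ * Real.sqrt C) ω :=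
      indicator_nonneg (fun _ _ => by positivity) ω
    rw [Real.norm_of_nonneg (add_nonneg hind (by positivity)), norm_div, norm_mul, norm_neg,
      Complex.norm_real, Complex.norm_real, Real.norm_of_nonneg hω0.le]
    rw [div_le_iff₀ hω0]
    change ‖F.coupling‖ * ‖s ω‖ ≤ _
    rcases lt_or_ge ω δ with h | h
    · rw [indicator_of_mem (show ω ∈ Ioc 0 δ from ⟨hω0, h.le⟩), add_mul]
      have h1 := mul_le_mul_of_nonneg_left (hω h) (norm_nonneg F.coupling)
      have h2 : 0 ≤ ‖F.coupling‖ / δ * ‖s ω‖ * ω := by positivity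
      linarith
    · rw [add_mul]
      have h1 : ‖F.coupling‖ * ‖s ω‖ ≤ ‖F.coupling‖ / δ * ‖s ω‖ * ω := by
        rw [div_mul_eq_mul_div, div_mul_eq_mul_div, le_div_iff₀ hδ]
        exact mul_le_mul_of_nonneg_left h (by positivity)
      have h2 := mul_nonneg hind hω0.le
      linarith

theorem IsExceptionalFirstKind.Q₁_mulVec_of_mem (hF : F.IsExceptionalFirstKind) {v : Fin N → ℂ}
    (hv : F.kernelMatrix.mulVec v = 0) : F.Q₁.mulVec v = v := by
  have : WithLp.toLp 2 v ∈ F.M₁ := by rw [hF.M₁_eq, mulVec_eq_zero_of_mem_M]; exact hv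
  have h := Q₁_mulVec (F := F) (WithLp.toLp 2 v)
  rwa [Submodule.starProjection_eq_self_iff.2 this] at h

/-- The compression of `Γ₁` to `M₁` is injective. -/
theorem IsExceptionalFirstKind.eq_zero_of_compressed (hF : F.IsExceptionalFirstKind) {v : Fin N → ℂ}
    (hv : F.Q₁.mulVec v = v) (h : F.Q₁.mulVec (F.Gam₁.mulVec v) = 0) : v = 0 := by
  have hM : WithLp.toLp 2 v ∈ F.M := by
    rw [mulVec_eq_zero_of_mem_M]
    change F.kernelMatrix.mulVec v = 0
    rw [← hv, Matrix.mulVec_mulVec, hF.kernelMatrix_mul_Q₁, Matrix.zero_mulVec]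
  -- `Q₁` is self-adjoint and fixes `v`, so it can be inserted in the form of `Γ₁` at `v`.
  have h0 : star v ⬝ᵥ F.Gam₁.mulVec v = 0 := by
    have : star v ⬝ᵥ F.Q₁.mulVec (F.Gam₁.mulVec v) = star v ⬝ᵥ F.Gam₁.mulVec v := by
      rw [Matrix.dotProduct_mulVec, ← Q₁_conjTranspose, ← Matrix.star_mulVec, hv]
    rw [← this, h, dotProduct_zero]
  have hmem : WithLp.toLp 2 v ∈ F.M₂ := by
    refine mem_M₂_of_form_eq_zero hM ?_
    rw [← h0]
    simp only [dotProduct, Matrix.mulVec, Finset.mul_sum, Pi.star_apply]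
    refine Finset.sum_congr rfl fun m _ => Finset.sum_congr rfl fun n _ => ?_
    rw [starRingEnd_apply]
    ring
  rw [hF.M₂_eq_bot, Submodule.mem_bot] at hmem
  exact (WithLp.toLp_eq_zero 2).1 hmem

/-- Completing `Q₁ Γ₁ Q₁` by the identity on `M₁^⊥` gives a matrix `Z` that is injective, hence
invertible, and commutes with `Q₁`; then `X = Q₁ Z⁻¹`. -/
theorem IsExceptionalFirstKind.exists_isInverseOnM₁ (hF : F.IsExceptionalFirstKind) :
    ∃ X, F.IsInverseOnM₁ X := by
  set Z : Matrix (Fin N) (Fin N) ℂ := F.compressedGam₁ + (1 - F.Q₁) with hZ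
  have hQc : F.Q₁ * F.compressedGam₁ = F.compressedGam₁ := by
    simp only [compressedGam₁, ← mul_assoc, Q₁_mul_self]
  have hcQ : F.compressedGam₁ * F.Q₁ = F.compressedGam₁ := by
    simp only [compressedGam₁, mul_assoc, Q₁_mul_self]
  have hQZ : F.Q₁ * Z = F.compressedGam₁ := by
    rw [hZ, mul_add, hQc, mul_sub, Q₁_mul_self, mul_one, sub_self, add_zero]
  have hZQ : Z * F.Q₁ = F.compressedGam₁ := by
    rw [hZ, add_mul, hcQ, sub_mul, Q₁_mul_self, one_mul, sub_self, add_zero]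
  have hunit : IsUnit Z := by
    rw [← Matrix.mulVec_injective_iff_isUnit]
    refine (injective_iff_map_eq_zero (Matrix.mulVecLin Z)).2 fun v hv => ?_
    rw [Matrix.mulVecLin_apply] at hv
    have h1 : F.compressedGam₁.mulVec v = 0 := by
      rw [← hQZ, ← Matrix.mulVec_mulVec, hv, Matrix.mulVec_zero]
    have h2 : F.Q₁.mulVec v = v := by
      rw [hZ, Matrix.add_mulVec, h1, zero_add, Matrix.sub_mulVec, Matrix.one_mulVec,
        sub_eq_zero] at hv
      exact hv.symm
    refine hF.eq_zero_of_compressed h2 ?_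
    rwa [compressedGam₁, ← Matrix.mulVec_mulVec, ← Matrix.mulVec_mulVec, h2] at h1
  obtain ⟨Y, hZY, hYZ⟩ := isUnit_iff_exists.1 hunit
  have hcomm : F.Q₁ * Y = Y * F.Q₁ := by
    calc F.Q₁ * Y = Y * (Z * F.Q₁) * Y := by rw [← mul_assoc Y, hYZ, one_mul]
      _ = Y * F.Q₁ := by rw [hZQ, ← hQZ, mul_assoc, mul_assoc, hZY, mul_one]
  refine ⟨F.Q₁ * Y, ?_, ?_, ?_, ?_⟩
  · rw [← mul_assoc, Q₁_mul_self]
  · rw [mul_assoc, ← hcomm, ← mul_assoc, Q₁_mul_self]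
  · rw [← mul_assoc, hcQ, ← hQZ, mul_assoc, hZY, mul_one]
  · rw [hcomm, mul_assoc, hQc, ← hZQ, ← mul_assoc, hYZ, one_mul]

/-- `K(0) + Γ₁ Q₁` is invertible, and the `Q₁` part of its inverse is `(Q₁ Γ₁ Q₁)⁻¹`. -/
theorem IsExceptionalFirstKind.exists_inverse (hF : F.IsExceptionalFirstKind)
    {X : Matrix (Fin N) (Fin N) ℂ} (hX : F.IsInverseOnM₁ X) :
    ∃ V, (F.kernelMatrix + F.Gam₁ * F.Q₁) * V = 1 ∧ V * (F.kernelMatrix + F.Gam₁ * F.Q₁) = 1 ∧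
      F.Q₁ * V = X := by
  obtain ⟨-, hXQ, -, hXc⟩ := hX
  -- `X = X Q₁` and `Q₁ K(0) = 0` eliminate `K(0)`. The identity gives injectivity (a null vector
  -- has `Q₁ v = 0`, then `K(0) v = 0`, so `v = Q₁ v = 0`) and also `X = Q₁ V`.
  have hXU : X * (F.kernelMatrix + F.Gam₁ * F.Q₁) = F.Q₁ := by
    calc X * (F.kernelMatrix + F.Gam₁ * F.Q₁)
        = X * F.Q₁ * (F.kernelMatrix + F.Gam₁ * F.Q₁) := by rw [hXQ]
      _ = X * (F.Q₁ * F.kernelMatrix) + X * F.compressedGam₁ := by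
          rw [compressedGam₁]; simp only [mul_add, mul_assoc]
      _ = F.Q₁ := by rw [hF.Q₁_mul_kernelMatrix, mul_zero, zero_add, hXc]
  have hunit : IsUnit (F.kernelMatrix + F.Gam₁ * F.Q₁) := by
    rw [← Matrix.mulVec_injective_iff_isUnit]
    refine (injective_iff_map_eq_zero (Matrix.mulVecLin _)).2 fun v hv => ?_
    rw [Matrix.mulVecLin_apply] at hv
    have h1 : F.Q₁.mulVec v = 0 := by
      rw [← hXU, ← Matrix.mulVec_mulVec, hv, Matrix.mulVec_zero]
    rw [Matrix.add_mulVec, ← Matrix.mulVec_mulVec, h1, Matrix.mulVec_zero, add_zero] at hv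
    rw [← hF.Q₁_mulVec_of_mem hv, h1]
  obtain ⟨V, hUV, hVU⟩ := isUnit_iff_exists.1 hunit
  refine ⟨V, hUV, hVU, ?_⟩
  rw [← hXU, mul_assoc, hUV, mul_one]

end FriedrichsModel

/-! ### The resolvent of the Friedrichs model -/

theorem IsResolventAt.eq {E : Type*} [NormedAddCommGroup E] [NormedSpace ℂ E] {T : E →ₗ.[ℂ] E}
    {z : ℂ} {R R' : E →L[ℂ] E} (hR : IsResolventAt T z R) (hR' : IsResolventAt T z R') : R = R' := by
  ext y
  obtain ⟨h, hy⟩ := hR'.1 y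
  have := hR.2 ⟨R' y, h⟩
  rwa [hy] at this

theorem IsResolventAt.unboundedResolvent_eq {E : Type*} [NormedAddCommGroup E] [NormedSpace ℂ E]
    {T : E →ₗ.[ℂ] E} {z : ℂ} {R : E →L[ℂ] E} (hR : IsResolventAt T z R) :
    unboundedResolvent T z = R := by
  have h : ∃ R : E →L[ℂ] E, IsResolventAt T z R := ⟨R, hR⟩
  rw [unboundedResolvent, dif_pos h]
  exact h.choose_spec.eq hR

/-- The resolvent of multiplication by `ω` on `L²((0, ∞))`. -/
theorem exists_resolvent_mul {z : ℂ} (hz : z ∈ cutPlane) :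
    ∃ T : Lp ℂ 2 halfLine →L[ℂ] Lp ℂ 2 halfLine,
      ∀ f : Lp ℂ 2 halfLine, T f =ᵐ[halfLine] fun ω => ((ω : ℂ) - z)⁻¹ * f ω := by
  obtain ⟨δ, hδ, hb⟩ := Metric.isOpen_iff.1 isOpen_cutPlane z hz
  have hmem : MemLp (fun ω : ℝ => ((ω : ℂ) - z)⁻¹) ⊤ halfLine := by
    refine memLp_top_of_bound (Complex.continuous_ofReal.sub
      continuous_const).measurable.inv.aestronglyMeasurable δ⁻¹ ?_
    filter_upwards [ae_restrict_mem measurableSet_Ioi] with ω hω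
    rw [norm_inv]
    gcongr
    by_contra! hlt
    exact hb (show (ω : ℂ) ∈ Metric.ball z δ by rwa [mem_ball_iff_norm])
      ⟨ω, (show (0 : ℝ) < ω from hω).le, rfl⟩
  refine ⟨(ContinuousLinearMap.mul ℂ ℂ).holderL halfLine ⊤ 2 2 (hmem.toLp _), fun f => ?_⟩
  have h := (ContinuousLinearMap.mul ℂ ℂ).coeFn_holder (r := 2) (hmem.toLp _) f
  filter_upwards [h, hmem.coeFn_toLp] with ω h1 h2
  rw [ContinuousLinearMap.holderL_apply_apply, h1, h2]
  rfl

namespace FriedrichsModel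

variable {N : ℕ} (F : FriedrichsModel N)

/-- `K₀ - z - λ² S(z)`, the inverse of the reduced resolvent. -/
noncomputable def feshbachMatrix (z : ℂ) : Matrix (Fin N) (Fin N) ℂ :=
  Matrix.diagonal (fun n => (F.level n : ℂ)) - z • 1 - (F.coupling : ℂ) ^ 2 • F.selfEnergy z

theorem mem_hamiltonian_domain {Ψ : FriedrichsSpace N} : Ψ ∈ F.hamiltonian.domain ↔
    MemLp (fun ω : ℝ => (ω : ℂ) * Ψ.snd ω) 2 halfLine := Iff.rfl

theorem hamiltonian_fst (Ψ : F.hamiltonian.domain) (n : Fin N) :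
    (F.hamiltonian Ψ).fst n = F.level n * (Ψ : FriedrichsSpace N).fst n +
      F.coupling * ⟪F.formFactor n, (Ψ : FriedrichsSpace N).snd⟫_ℂ := by
  rw [add_comm]
  rfl

theorem hamiltonian_snd (Ψ : F.hamiltonian.domain) :
    (F.hamiltonian Ψ).snd = MemLp.toLp (fun ω : ℝ => (ω : ℂ) * (Ψ : FriedrichsSpace N).snd ω) Ψ.2 +
      (F.coupling : ℂ) • ∑ n, (Ψ : FriedrichsSpace N).fst n • F.formFactor n := by
  rw [add_comm]
  rfl

/-- `f ↦ (⟨v_n, f⟩)_n`. -/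
noncomputable def annihilate : Lp ℂ 2 halfLine →L[ℂ] EuclideanSpace ℂ (Fin N) :=
  (PiLp.continuousLinearEquiv 2 ℂ (fun _ : Fin N => ℂ)).symm.toContinuousLinearMap ∘L
    ContinuousLinearMap.pi fun n => innerSL ℂ (F.formFactor n)

/-- `c ↦ ∑ c_n v_n`. -/
noncomputable def create : EuclideanSpace ℂ (Fin N) →L[ℂ] Lp ℂ 2 halfLine :=
  ∑ n, (PiLp.proj 2 (fun _ : Fin N => ℂ) n : EuclideanSpace ℂ (Fin N) →L[ℂ] ℂ).smulRight
    (F.formFactor n)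

theorem annihilate_apply (f : Lp ℂ 2 halfLine) (n : Fin N) :
    F.annihilate f n = ⟪F.formFactor n, f⟫_ℂ := rfl

theorem create_apply (c : EuclideanSpace ℂ (Fin N)) : F.create c = ∑ n, c n • F.formFactor n := by
  simp [create]

-- The self energy enters as the free resolvent sandwiched between the two halves of the
-- interaction.
variable {F} in
theorem annihilate_resolvent_create {z : ℂ} {T : Lp ℂ 2 halfLine →L[ℂ] Lp ℂ 2 halfLine}
    (hT : ∀ f : Lp ℂ 2 halfLine, T f =ᵐ[halfLine] fun ω => ((ω : ℂ) - z)⁻¹ * f ω)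
    (c : EuclideanSpace ℂ (Fin N)) :
    F.annihilate (T (F.create c)) = WithLp.toLp 2 ((F.selfEnergy z).mulVec c.ofLp) := by
  ext n
  rw [annihilate_apply, create_apply, map_sum, inner_sum]
  simp only [map_smul, inner_smul_right, Matrix.mulVec, dotProduct]
  refine Finset.sum_congr rfl fun m _ => ?_
  rw [mul_comm, L2.inner_def, selfEnergy, Matrix.of_apply]
  congr 1
  refine integral_congr_ae ?_
  filter_upwards [hT (F.formFactor m)] with ω hω
  rw [hω, RCLike.inner_apply]
  ring

/-- The Feshbach formula for the resolvent of the Friedrichs Hamiltonian. -/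
theorem exists_isResolventAt {z : ℂ} (hz : z ∈ cutPlane) {Y : Matrix (Fin N) (Fin N) ℂ}
    (h1 : F.feshbachMatrix z * Y = 1) (h2 : Y * F.feshbachMatrix z = 1) :
    ∃ R, IsResolventAt F.hamiltonian z R ∧
      ∀ m n, ⟪(ket m : FriedrichsSpace N), R (ket n)⟫_ℂ = Y m n := by
  obtain ⟨T, hT⟩ := exists_resolvent_mul hz
  -- Solving `(H - z)(c, f) = y`: the second row gives `f = T (y₂ - λ ∑ c_n v_n)`, and substitution
  -- in the first leaves the Feshbach matrix acting on `c`.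
  set c : FriedrichsSpace N →L[ℂ] EuclideanSpace ℂ (Fin N) :=
    (Matrix.toEuclideanCLM (𝕜 := ℂ) (n := Fin N) Y) ∘L (WithLp.fstL 2 ℂ _ _ -
      (F.coupling : ℂ) • F.annihilate ∘L T ∘L WithLp.sndL 2 ℂ _ _)
  set f : FriedrichsSpace N →L[ℂ] Lp ℂ 2 halfLine :=
    T ∘L (WithLp.sndL 2 ℂ _ _ - (F.coupling : ℂ) • F.create ∘L c)
  set R : FriedrichsSpace N →L[ℂ] FriedrichsSpace N :=
    (WithLp.prodContinuousLinearEquiv 2 ℂ _ _).symm.toContinuousLinearMap ∘L (c.prod f)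
  have hRf : ∀ y, (R y).snd = f y := fun y => rfl
  have hca : ∀ y, c y = WithLp.toLp 2 (Y.mulVec
      (y.fst - (F.coupling : ℂ) • F.annihilate (T y.snd)).ofLp) := fun y => rfl
  have hfa : ∀ y, f y = T (y.snd - (F.coupling : ℂ) • F.create (c y)) := fun y => rfl
  -- `ω (ω - z)⁻¹ = 1 + z (ω - z)⁻¹`; in particular `T` maps into the domain of multiplication by
  -- `ω`.
  have hTdom : ∀ k : Lp ℂ 2 halfLine, (fun ω : ℝ => (ω : ℂ) * T k ω) =ᵐ[halfLine]
      ((k + z • T k : Lp ℂ 2 halfLine) : ℝ → ℂ) := by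
    intro k
    filter_upwards [hT k, Lp.coeFn_add k (z • T k), Lp.coeFn_smul z (T k),
      ae_restrict_mem measurableSet_Ioi] with ω e1 e2 e3 hω
    have := ofReal_sub_ne_zero_of_mem_cutPlane hz (show (0 : ℝ) < ω from hω).le
    rw [e2, Pi.add_apply, e3, Pi.smul_apply, e1, smul_eq_mul]
    field_simp
    ring
  have hfesh : ∀ v : Fin N → ℂ, ∀ n, (F.feshbachMatrix z).mulVec v n =
      F.level n * v n - z * v n - F.coupling ^ 2 * (F.selfEnergy z).mulVec v n := by
    intro v n
    simp [feshbachMatrix, Matrix.sub_mulVec, Matrix.smul_mulVec, Matrix.mulVec_diagonal]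
  refine ⟨R, ⟨fun y => ?_, fun x => ?_⟩, fun m n => ?_⟩
  · have hdom : R y ∈ F.hamiltonian.domain := by
      rw [mem_hamiltonian_domain, hRf, hfa]
      exact (memLp_congr_ae (hTdom _)).2 (Lp.memLp _)
    refine ⟨hdom, ?_⟩
    apply (WithLp.equiv 2 _).injective
    refine Prod.ext ?_ ?_
    · ext n
      change (F.hamiltonian ⟨R y, hdom⟩).fst n - z * (R y).fst n = y.fst n
      rw [hamiltonian_fst]
      change F.level n * c y n + F.coupling * F.annihilate (f y) n - z * c y n = y.fst n
      have e1 := congrFun (congrArg (fun A => Matrix.mulVec A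
        (y.fst - (F.coupling : ℂ) • F.annihilate (T y.snd)).ofLp) h1) n
      simp only [← Matrix.mulVec_mulVec, Matrix.one_mulVec] at e1
      rw [hfesh] at e1
      rw [hfa, map_sub, map_sub, map_smul, map_smul, annihilate_resolvent_create hT]
      simp only [hca, PiLp.sub_apply, PiLp.smul_apply, smul_eq_mul] at e1 ⊢
      linear_combination e1
    · change (F.hamiltonian ⟨R y, hdom⟩).snd - z • (R y).snd = y.snd
      rw [hamiltonian_snd, ← create_apply]
      have : MemLp.toLp _ hdom = (y.snd - (F.coupling : ℂ) • F.create (c y)) + z • f y := by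
        refine Lp.ext ((MemLp.coeFn_toLp _).trans ((hTdom _)))
      change MemLp.toLp _ hdom + (F.coupling : ℂ) • F.create (c y) - z • f y = y.snd
      rw [this]
      abel
  · obtain ⟨x, hx⟩ := x
    have hx' : MemLp (fun ω : ℝ => (ω : ℂ) * x.snd ω) 2 halfLine := hx
    set y := F.hamiltonian ⟨x, hx⟩ - z • x with hy
    have hTx : T (hx'.toLp _ - z • x.snd) = x.snd := by
      refine Lp.ext ?_
      filter_upwards [hT (hx'.toLp _ - z • x.snd), Lp.coeFn_sub (hx'.toLp _) (z • x.snd),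
        Lp.coeFn_smul z x.snd, hx'.coeFn_toLp, ae_restrict_mem measurableSet_Ioi]
        with ω e1 e2 e3 e4 hω
      have := ofReal_sub_ne_zero_of_mem_cutPlane hz (show (0 : ℝ) < ω from hω).le
      rw [e1, e2, Pi.sub_apply, e3, e4, Pi.smul_apply, smul_eq_mul]
      field_simp
    have hys : y.snd = (hx'.toLp _ - z • x.snd) + (F.coupling : ℂ) • F.create x.fst := by
      rw [hy, WithLp.sub_snd, hamiltonian_snd, ← create_apply, WithLp.smul_snd]
      abel
    have hcy : c y = x.fst := by
      have e0 : (y.fst - (F.coupling : ℂ) • F.annihilate (T y.snd)).ofLp =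
          (F.feshbachMatrix z).mulVec x.fst.ofLp := by
        ext n
        rw [hfesh, hys, map_add, map_add, hTx, map_smul, map_smul, annihilate_resolvent_create hT]
        have : y.fst n = F.level n * x.fst n + F.coupling * F.annihilate x.snd n - z * x.fst n := by
          rw [annihilate_apply, ← F.hamiltonian_fst ⟨x, hx⟩ n]
          rfl
        simp only [PiLp.sub_apply, PiLp.smul_apply, PiLp.add_apply, smul_eq_mul, this]
        ring
      rw [hca, e0, Matrix.mulVec_mulVec, h2, Matrix.one_mulVec]
    apply (WithLp.equiv 2 _).injective
    refine Prod.ext ?_ ?_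
    · exact hcy
    · change f y = x.snd
      rw [hfa, hcy, hys, add_sub_cancel_right, hTx]
  · rw [WithLp.prod_inner_apply]
    change ⟪EuclideanSpace.single m (1 : ℂ), c (ket n)⟫_ℂ + ⟪(0 : Lp ℂ 2 halfLine), f (ket n)⟫_ℂ = _
    rw [inner_zero_left, add_zero, EuclideanSpace.inner_single_left, hca]
    change conj (1 : ℂ) * Y.mulVec (EuclideanSpace.single n (1 : ℂ) - (F.coupling : ℂ) •
      F.annihilate (T 0)).ofLp m = _
    rw [map_zero, map_zero, smul_zero, sub_zero, map_one, one_mul]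
    change Y.mulVec (Pi.single n 1) m = _
    simp

theorem mem_resolventSet_and_reducedResolvent_eq {z : ℂ} (hz : z ∈ cutPlane)
    {Y : Matrix (Fin N) (Fin N) ℂ} (h1 : F.feshbachMatrix z * Y = 1)
    (h2 : Y * F.feshbachMatrix z = 1) :
    z ∈ unboundedResolventSet F.hamiltonian ∧ F.reducedResolvent z = Y := by
  obtain ⟨R, hR, hRY⟩ := F.exists_isResolventAt hz h1 h2
  refine ⟨⟨R, hR⟩, ?_⟩
  ext m n
  rw [reducedResolvent, hR.unboundedResolvent_eq]
  exact hRY m n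

end FriedrichsModel

/-! ### Threshold expansion of the reduced resolvent -/

namespace FriedrichsModel

variable {N : ℕ} {F : FriedrichsModel N}

variable (F) in
theorem feshbachMatrix_eq (z : ℂ) : F.feshbachMatrix z = F.kernelMatrix - z • 1 -
    (F.coupling : ℂ) ^ 2 • F.regularPart z +
      ((F.coupling : ℂ) ^ 2 * Complex.log (-z)) • F.Gam z := by
  rw [feshbachMatrix, kernelMatrix, regularPart]
  module

/-- The expansion of the reduced resolvent in terms of the branch `log (-z) + s π i`. -/
theorem IsExceptionalFirstKind.reducedResolvent_expansion (hF : F.IsExceptionalFirstKind)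
    {X : Matrix (Fin N) (Fin N) ℂ} (hX : F.IsInverseOnM₁ X)
    {α : ℂ → Matrix (Fin N) (Fin N) ℂ} (hα : AnalyticAt ℂ α 0)
    (hαe : ∀ᶠ z in 𝓝[cutPlane] (0 : ℂ), F.regularPart z = z • α z) (s : ℂ) {L : ℂ → ℂ}
    (hL : ∀ z, L z = Complex.log (-z) + s * Real.pi * Complex.I) :
    (∀ᶠ z in 𝓝[cutPlane] (0 : ℂ), z ∈ unboundedResolventSet F.hamiltonian ∧
      DifferentiableAt ℂ F.reducedResolvent z) ∧
    (∀ᶠ z in 𝓝[cutPlane] (0 : ℂ), DifferentiableAt ℂ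
      (fun z : ℂ => F.reducedResolvent z - F.twoTermSeries X (α 0) s (L z) z) z) ∧
    ((fun z : ℂ => F.reducedResolvent z - F.twoTermSeries X (α 0) s (L z) z)
      =O[𝓝[cutPlane] 0] fun z : ℂ => (z * L z ^ 3)⁻¹) ∧
    ((deriv fun z : ℂ => F.reducedResolvent z - F.twoTermSeries X (α 0) s (L z) z)
      =O[𝓝[cutPlane] 0] fun z : ℂ => (z ^ 2 * L z ^ 3)⁻¹) := by
  obtain ⟨γ, hγ, hγ0, hγe⟩ := F.exists_Gam_eq
  obtain ⟨V, hUV, hVU, hQV⟩ := hF.exists_inverse hX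
  have hbranch : IsLogBranch (𝓝[cutPlane] 0) L := by
    rw [show L = fun z => Complex.log (-z) + s * Real.pi * Complex.I from funext hL]
    exact isLogBranch_log_neg_add _
  rw [← hγ0] at hUV hVU
  -- Applied with `κ = λ²` and `c = s π i`, so that `log (-z) = L - c`.
  obtain ⟨R, ε, ε', hR, hRe, hεd, hε, hε'⟩ := threshold_expansion hbranch nhdsWithin_le_nhds
    (s * Real.pi * Complex.I) (pow_ne_zero 2 hF.coupling_ne_zero) hα hγ Q₁_mul_self
    hF.kernelMatrix_mul_Q₁ hX.1 hX.2.1 hUV hVU hQV F.feshbachMatrix (by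
      filter_upwards [hαe] with z hz
      rw [feshbachMatrix_eq, hz, hγe, hL, smul_smul, smul_smul]
      congr 2
      ring)
  have hres : ∀ᶠ z in 𝓝[cutPlane] (0 : ℂ),
      z ∈ unboundedResolventSet F.hamiltonian ∧ F.reducedResolvent z = R z := by
    filter_upwards [hR, self_mem_nhdsWithin] with z hz hzc using
      F.mem_resolventSet_and_reducedResolvent_eq hzc hz.1 hz.2
  have hseries : ∀ z, R z = F.twoTermSeries X (α 0) s (L z) z + ε z := by
    intro z
    rw [hRe, twoTermSeries, compressedGam₁, hγ0, ← pow_mul,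
      show (F.coupling : ℂ) ^ 2 * (s * Real.pi * Complex.I) =
        s * (F.coupling : ℂ) ^ 2 * Real.pi * Complex.I by ring]
  have heq : ∀ᶠ z in 𝓝[cutPlane] (0 : ℂ),
      F.reducedResolvent z - F.twoTermSeries X (α 0) s (L z) z = ε z := by
    filter_upwards [hres] with z hz
    rw [hz.2, hseries, add_sub_cancel_left]
  have hd : ∀ᶠ z in 𝓝[cutPlane] (0 : ℂ), HasDerivAt
      (fun z : ℂ => F.reducedResolvent z - F.twoTermSeries X (α 0) s (L z) z) (ε' z) z := by
    -- The remainder agrees with `ε` on a full neighbourhood of `z`, so the two have the same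
    -- derivative.
    filter_upwards [hεd, eventually_eventually_nhds_cutPlane heq] with z hz hz' using
      hz.congr_of_eventuallyEq hz'
  refine ⟨?_, hd.mono fun z hz => hz.differentiableAt, ?_, ?_⟩
  · filter_upwards [hres, hd, hbranch.hasDerivAt, hbranch.ne_zero, hbranch.log_ne_zero] with
      z hz hdz hLz hz0 hL0
    refine ⟨hz.1, ?_⟩
    have hc := hF.coupling_ne_zero
    have hLd := hLz.differentiableAt
    have hser : DifferentiableAt ℂ (fun z => F.twoTermSeries X (α 0) s (L z) z) z := by
      unfold twoTermSeries
      refine DifferentiableAt.add (DifferentiableAt.smul_const ?_ _)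
        (DifferentiableAt.smul_const ?_ _)
      · exact ((differentiableAt_id.const_mul _).mul hLd).inv
          (mul_ne_zero (mul_ne_zero (pow_ne_zero 2 hc) hz0) hL0)
      · exact ((differentiableAt_id.const_mul _).mul (hLd.pow 2)).inv
          (mul_ne_zero (mul_ne_zero (pow_ne_zero 4 hc) hz0) (pow_ne_zero 2 hL0))
    simpa using hdz.differentiableAt.fun_add hser
  · exact hε.congr' (heq.mono fun z hz => hz.symm) EventuallyEq.rfl
  · exact hε'.congr' (hd.mono fun z hz => hz.deriv.symm) EventuallyEq.rfl

end FriedrichsModel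

theorem mainTheorem4 {N : ℕ} (F : FriedrichsModel N) (hF : F.IsExceptionalFirstKind) :
    -- `A₁` is the coefficient in `A(z) = z A₁ + O(z²)`, and `X = (Q₁ Γ₁ Q₁)⁻¹` in `M₁`
    ∃ A₁ X : Matrix (Fin N) (Fin N) ℂ,
      ((fun z : ℂ => F.regularPart z - z • A₁) =O[𝓝[cutPlane] 0] fun z : ℂ => z ^ 2) ∧
      F.IsInverseOnM₁ X ∧
      -- near `0` in the cut plane the reduced resolvent is defined and differentiable
      (∀ᶠ z in 𝓝[cutPlane] (0 : ℂ), z ∈ unboundedResolventSet F.hamiltonian ∧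
        DifferentiableAt ℂ F.reducedResolvent z) ∧
      -- expansion in terms of `log z`, with `r = 0` and `r = 1`
      ((∀ᶠ z in 𝓝[cutPlane] (0 : ℂ), DifferentiableAt ℂ
          (fun z : ℂ => F.reducedResolvent z - F.twoTermSeries X A₁ 1 (cutLog z) z) z) ∧
        ((fun z : ℂ => F.reducedResolvent z - F.twoTermSeries X A₁ 1 (cutLog z) z)
          =O[𝓝[cutPlane] 0] fun z : ℂ => (z * cutLog z ^ 3)⁻¹) ∧
        ((deriv fun z : ℂ => F.reducedResolvent z - F.twoTermSeries X A₁ 1 (cutLog z) z)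
          =O[𝓝[cutPlane] 0] fun z : ℂ => (z ^ 2 * cutLog z ^ 3)⁻¹)) ∧
      -- expansion in terms of `log z - 2πi`, with `r = 0` and `r = 1`
      ((∀ᶠ z in 𝓝[cutPlane] (0 : ℂ), DifferentiableAt ℂ
          (fun z : ℂ => F.reducedResolvent z -
            F.twoTermSeries X A₁ (-1) (cutLog z - 2 * Real.pi * Complex.I) z) z) ∧
        ((fun z : ℂ => F.reducedResolvent z -
            F.twoTermSeries X A₁ (-1) (cutLog z - 2 * Real.pi * Complex.I) z)
          =O[𝓝[cutPlane] 0] fun z : ℂ =>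
            (z * (cutLog z - 2 * Real.pi * Complex.I) ^ 3)⁻¹) ∧
        ((deriv fun z : ℂ => F.reducedResolvent z -
            F.twoTermSeries X A₁ (-1) (cutLog z - 2 * Real.pi * Complex.I) z)
          =O[𝓝[cutPlane] 0] fun z : ℂ =>
            (z ^ 2 * (cutLog z - 2 * Real.pi * Complex.I) ^ 3)⁻¹)) := by
  obtain ⟨X, hX⟩ := hF.exists_isInverseOnM₁
  obtain ⟨α, hα, hαe⟩ := F.exists_regularPart_eq
  -- `log z = log (-z) + π i` is the case `s = 1`, and `log z - 2πi = log (-z) - π i` the case `s =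
  -- -1`.
  have h1 := hF.reducedResolvent_expansion hX hα hαe 1 (L := cutLog) fun z => by
    rw [cutLog, one_mul]
  have h2 := hF.reducedResolvent_expansion hX hα hαe (-1)
    (L := fun z => cutLog z - 2 * Real.pi * Complex.I) fun z => by
      rw [cutLog]; ring
  refine ⟨α 0, X, ?_, hX, h1.1, h1.2, h2.2⟩
  have hα0 : (fun z => α z - α 0) =O[𝓝[cutPlane] 0] fun z => z := by
    simpa using hα.differentiableAt.isBigO_sub.mono nhdsWithin_le_nhds
  refine ((isBigO_refl (fun z : ℂ => z) _).smul hα0).congr' ?_ (.of_forall fun z => ?_)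
  · filter_upwards [hαe] with z hz
    rw [hz, smul_sub]
  · simp only [smul_eq_mul, sq]
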